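/- Let $K$ be a field, let $n\ge 1$, and let $\mathbf a=(a_1,\dots,a_n)$ be a sequence of positive integers with $a_i<a_n$ for all $i<n$. Put $S=K[x_1,\dots,x_n]$ and let $I(\mathbf a)\subset S$ be the kernel of the $K$-algebra homomorphism $S\to K[t]$, $x_i\mapsto t^{a_i}$. Let $I(\mathbf a)^h\subset S[x_0]$ be the homogenization of $I(\mathbf a)$ with respect to $x_0$, that is, the ideal generated by the homogenizations $f^h$ of all $f\in I(\mathbf a)$; it is the homogeneous ideal of the projective monomial curve $\overline{C(\mathbf a)}$ (its vanishing ideal when $K$ is algebraically closed). The curve $\overline{C(\mathbf a)}$ is called arithmetically Cohen–Macaulay if $I(\mathbf a)^h$ is a Cohen–Macaulay ideal, where an ideal $J$ of a ring $R$ is called Cohen–Macaulay if $R/J$ is a Cohen–Macaulay ring. Let $<$ be any (graded) reverse lexicographic order on $S$ for which $x_n$ is the smallest variable (the other variables may be ordered in any way), and let $<_0$ be the induced reverse lexicographic order on $S[x_0]$, in which $x_1,\dots,x_n$ are ordered as before and $x_0$ is smaller than all of them. For an ideal $J$ let $\mathrm{in}(J)$ denote its initial ideal, and for a monomial ideal $J$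 let $G(J)$ denote its minimal set of monomial generators. Then the following conditions are equivalent: (a) $\overline{C(\mathbf a)}$ is arithmetically Cohen–Macaulay; (b) $\mathrm{in}_{<_0}(I(\mathbf a)^h)$ is a Cohen–Macaulay ideal; (c) $\mathrm{in}_<(I(\mathbf a))$ is a Cohen–Macaulay ideal; (d) $x_n$ does not divide any element of $G(\mathrm{in}_<(I(\mathbf a)))$; (e) neither $x_n$ nor $x_0$ divides any element of $G(\mathrm{in}_{<_0}(I(\mathbf a)^h))$; (f) $x_n$ does not divide any element of $G(\mathrm{in}_{<_0}(I(\mathbf a)^h))$; (g) $\mathrm{in}_<\big((x_n)+I(\mathbf a)\big)=(x_n)+\mathrm{in}_<(I(\mathbf a))$. -/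

import Mathlib

/-! ### The graded reverse lexicographic order -/

/-- Exponent vectors of monomials in the variables `X i`, `i : σ`, to be ordered by the graded
reverse lexicographic order attached to a ranking `ρ : σ ↪ ℕ` of the variables
(`X i` is smaller than `X j` iff `ρ i < ρ j`). -/
def DegRevLex {σ : Type*} (_ρ : σ ↪ ℕ) : Type _ := σ →₀ ℕ

namespace DegRevLex

variable {σ : Type*} (ρ : σ ↪ ℕ)

noncomputable instance : AddCommMonoid (DegRevLex ρ) := inferInstanceAs (AddCommMonoid (σ →₀ ℕ))

/-- The comparison key: first the degree, then the exponents listed from the smallest variable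
upwards, compared lexicographically with the reversed outcome. -/
noncomputable def key (α : DegRevLex ρ) : ℕ ×ₗ (Lex (ℕ →₀ ℕ))ᵒᵈ :=
  toLex (Finsupp.degree (show σ →₀ ℕ from α),
    OrderDual.toDual (toLex (Finsupp.embDomain ρ (show σ →₀ ℕ from α))))

theorem key_injective : Function.Injective (key ρ) := by
  intro α β h
  have h2 := congrArg Prod.snd (congrArg ofLex h)
  exact Finsupp.embDomain_injective ρ (congrArg ofLex (congrArg OrderDual.ofDual h2))

noncomputable instance : LinearOrder (DegRevLex ρ) := LinearOrder.lift' (key ρ) (key_injective ρ)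

/-- `α < β` iff `deg α < deg β`, or the degrees agree and `α` has the larger exponent at the
smallest variable at which `α` and `β` differ. -/
theorem lt_iff (α β : σ →₀ ℕ) :
    @LT.lt (DegRevLex ρ) _ α β ↔ α.degree < β.degree ∨ (α.degree = β.degree ∧
      ∃ i, β i < α i ∧ ∀ j, ρ j < ρ i → α j = β j) := by
  have h0 : @LT.lt (DegRevLex ρ) _ α β ↔ key ρ α < key ρ β := Iff.rfl
  rw [h0]
  unfold key
  rw [Prod.Lex.toLex_lt_toLex]
  refine or_congr Iff.rfl (and_congr Iff.rfl ?_)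
  show toLex (Finsupp.embDomain ρ β) < toLex (Finsupp.embDomain ρ α) ↔ _
  rw [Finsupp.Lex.lt_iff]
  constructor
  · rintro ⟨k, hk, hlt⟩
    simp only [ofLex_toLex] at hk hlt
    by_cases hr : k ∈ Set.range ρ
    · obtain ⟨i, rfl⟩ := hr
      rw [Finsupp.embDomain_apply_self, Finsupp.embDomain_apply_self] at hlt
      refine ⟨i, hlt, fun j hj => ?_⟩
      have := hk (ρ j) hj
      rw [Finsupp.embDomain_apply_self, Finsupp.embDomain_apply_self] at this
      exact this.symm
    · rw [Finsupp.embDomain_of_notMem_range _ _ _ hr, Finsupp.embDomain_of_notMem_range _ _ _ hr] at hlt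
      exact absurd hlt (lt_irrefl _)
  · rintro ⟨i, hi, h⟩
    refine ⟨ρ i, fun k hk => ?_, ?_⟩
    · simp only [ofLex_toLex]
      by_cases hr : k ∈ Set.range ρ
      · obtain ⟨j, rfl⟩ := hr
        rw [Finsupp.embDomain_apply_self, Finsupp.embDomain_apply_self]
        exact (h j hk).symm
      · rw [Finsupp.embDomain_of_notMem_range _ _ _ hr, Finsupp.embDomain_of_notMem_range _ _ _ hr]
    · simp only [ofLex_toLex]
      rw [Finsupp.embDomain_apply_self, Finsupp.embDomain_apply_self]
      exact hi

instance : IsOrderedAddMonoid (DegRevLex ρ) where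
  add_le_add_left := by
    intro α β h γ
    rcases h.eq_or_lt with rfl | h
    · exact le_rfl
    · refine le_of_lt ((lt_iff ρ _ _).2 ?_)
      change (Finsupp.degree ((show σ →₀ ℕ from α) + (show σ →₀ ℕ from γ)) <
        Finsupp.degree ((show σ →₀ ℕ from β) + (show σ →₀ ℕ from γ))) ∨
        (Finsupp.degree ((show σ →₀ ℕ from α) + (show σ →₀ ℕ from γ)) =
          Finsupp.degree ((show σ →₀ ℕ from β) + (show σ →₀ ℕ from γ)) ∧ _)
      rcases (lt_iff ρ _ _).1 h with h | ⟨hd, i, hi, hj⟩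
      · left
        rw [map_add, map_add]
        exact Nat.add_lt_add_right h _
      · right
        refine ⟨by rw [map_add, map_add, hd], i, Nat.add_lt_add_right hi _, fun j hlt => ?_⟩
        exact congrArg (· + (show σ →₀ ℕ from γ) j) (hj j hlt)

/-- The identity, as an additive equivalence. -/
noncomputable def ofExponent : (σ →₀ ℕ) ≃+ DegRevLex ρ := AddEquiv.refl (σ →₀ ℕ)

theorem ofExponent_monotone : Monotone (ofExponent ρ) := by
  intro α β h
  obtain ⟨γ, rfl⟩ := exists_add_of_le h
  rw [map_add]
  refine le_add_of_nonneg_right ?_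
  by_cases hγ : γ = 0
  · subst hγ; exact (map_zero _).ge
  · refine le_of_lt ((lt_iff ρ 0 γ).2 (Or.inl ?_))
    rw [map_zero]
    exact Nat.pos_of_ne_zero fun h => hγ ((Finsupp.degree_eq_zero_iff γ).1 h)

instance [Finite σ] : WellFoundedLT (DegRevLex ρ) := by
  have hw : WellQuasiOrderedLE (σ →₀ ℕ) := inferInstance
  refine ⟨wellFounded_iff_isEmpty_descending_chain.2 ⟨fun ⟨f, hf⟩ => ?_⟩⟩
  obtain ⟨m, k, hmk, hle⟩ := hw.wqo (fun k => (show σ →₀ ℕ from f k))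
  have h1 : f m ≤ f k := ofExponent_monotone ρ hle
  have h2 : ∀ k, f (k + 1) < f k := hf
  exact absurd (strictAnti_nat_of_succ_lt h2 hmk) (not_lt.2 h1)

end DegRevLex

/-- The graded reverse lexicographic monomial order for which `X i` is smaller than `X j`
iff `ρ i < ρ j`. -/
noncomputable def degRevLex {σ : Type*} [Finite σ] (ρ : σ ↪ ℕ) : MonomialOrder σ where
  syn := DegRevLex ρ
  toSyn := DegRevLex.ofExponent ρ
  toSyn_monotone := DegRevLex.ofExponent_monotone ρ

open scoped MonomialOrder in
theorem degRevLex_lt_iff {σ : Type*} [Finite σ] (ρ : σ ↪ ℕ) (α β : σ →₀ ℕ) :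
    α ≺[degRevLex ρ] β ↔ α.degree < β.degree ∨ (α.degree = β.degree ∧
      ∃ i, β i < α i ∧ ∀ j, ρ j < ρ i → α j = β j) :=
  DegRevLex.lt_iff ρ α β

/-- From a ranking of `x_1, …, x_n` (indexed by `Fin n`), the ranking of `x_0, x_1, …, x_n`
(indexed by `Fin (n + 1)`) that keeps the order of the old variables and makes `x_0` the
smallest variable. -/
def extendRanking {n : ℕ} (ρ : Fin n ↪ ℕ) : Fin (n + 1) ↪ ℕ where
  toFun := Fin.cons 0 (fun i => ρ i + 1)
  inj' := by
    intro i j h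
    induction i using Fin.cases with
    | zero =>
      induction j using Fin.cases with
      | zero => rfl
      | succ j => simp at h
    | succ i =>
      induction j using Fin.cases with
      | zero => simp at h
      | succ j =>
        simp only [Fin.cons_succ, add_left_inj, EmbeddingLike.apply_eq_iff_eq] at h
        rw [h]

/-! ### Initial ideals and minimal monomial generators -/

/-- The initial ideal of `I`: the ideal generated by the initial monomials of the nonzero
elements of `I`. -/
noncomputable def initialIdeal {σ K : Type*} [Field K] (m : MonomialOrder σ)
    (I : Ideal (MvPolynomial σ K)) : Ideal (MvPolynomial σ K) :=
  Ideal.span {u | ∃ f ∈ I, f ≠ 0 ∧ u = MvPolynomial.monomial (m.degree f) 1}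

/-- The minimal monomial generators `G(J)` of a monomial ideal `J`: the monomials of `J` that are
minimal with respect to divisibility. -/
def minimalMonomialGenerators {σ K : Type*} [Field K] (J : Ideal (MvPolynomial σ K)) :
    Set (MvPolynomial σ K) :=
  {u | ∃ α : σ →₀ ℕ, Minimal (fun β => MvPolynomial.monomial β (1 : K) ∈ J) α ∧
    u = MvPolynomial.monomial α 1}

/-! ### Homogenization -/

/-- The homogenization `f^h` of `f ∈ K[x_1, …, x_n]` in `K[x_0, …, x_n]`: every monomial `x^α` of
`f` is multiplied by `x_0 ^ (deg f - deg x^α)`. The variable `x_i` has index `i - 1` in `Fin n`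
and index `i` in `Fin (n + 1)`. -/
noncomputable def homogenizePoly {K : Type*} [Field K] {n : ℕ} (f : MvPolynomial (Fin n) K) :
    MvPolynomial (Fin (n + 1)) K :=
  ∑ α ∈ f.support, MvPolynomial.monomial (Finsupp.cons (f.totalDegree - α.degree) α) (f.coeff α)

/-- The homogenization `I^h` of an ideal `I`: the ideal generated by all `f^h` with `f ∈ I`. -/
noncomputable def homogenizeIdeal {K : Type*} [Field K] {n : ℕ}
    (I : Ideal (MvPolynomial (Fin n) K)) : Ideal (MvPolynomial (Fin (n + 1)) K) :=
  Ideal.span (homogenizePoly '' (I : Set (MvPolynomial (Fin n) K)))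

/-! ### Cohen-Macaulay rings and ideals -/

/-- A Noetherian local ring is Cohen-Macaulay if its maximal ideal contains a regular sequence
whose length is the Krull dimension of the ring. -/
def IsCohenMacaulayLocalRing (R : Type*) [CommRing R] [IsLocalRing R] : Prop :=
  IsNoetherianRing R ∧ ∃ rs : List R, (∀ r ∈ rs, r ∈ IsLocalRing.maximalIdeal R) ∧
    RingTheory.Sequence.IsRegular R rs ∧ (rs.length : WithBot ℕ∞) = ringKrullDim R

/-- A Noetherian ring is Cohen-Macaulay if its localizations at all maximal ideals are. -/
def IsCohenMacaulayRing (R : Type*) [CommRing R] : Prop :=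
  IsNoetherianRing R ∧ ∀ (p : Ideal R) [p.IsMaximal],
    IsCohenMacaulayLocalRing (Localization.AtPrime p)

/-- An ideal `J` of `R` is a Cohen-Macaulay ideal if `R ⧸ J` is a Cohen-Macaulay ring. -/
def IsCohenMacaulayIdeal {R : Type*} [CommRing R] (J : Ideal R) : Prop :=
  IsCohenMacaulayRing (R ⧸ J)

/-! ### Monomial curves -/

/-- The toric ideal `I(a)`: the kernel of `K[x_1, …, x_n] → K[t]`, `x_i ↦ t ^ a_i`. -/
noncomputable def monomialCurveIdeal (K : Type*) [Field K] {n : ℕ} (a : Fin n → ℕ) :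
    Ideal (MvPolynomial (Fin n) K) :=
  RingHom.ker (MvPolynomial.aeval (R := K) (fun i => (Polynomial.X : Polynomial K) ^ a i))

/-- The projective monomial curve attached to `a` is arithmetically Cohen-Macaulay: its
homogeneous ideal `I(a)^h` in `K[x_0, …, x_n]` is a Cohen-Macaulay ideal. -/
def IsArithmeticallyCohenMacaulay (K : Type*) [Field K] {n : ℕ} (a : Fin n → ℕ) : Prop :=
  IsCohenMacaulayIdeal (homogenizeIdeal (monomialCurveIdeal K a))

/-!
The variables are called `x_1, …, x_n` and `x_0` here; `x_0` is the variable with index `0` after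
homogenization.

Everything is read off the set `E(I)` of exponents of initial monomials of an ideal `I`. That `x_i`
divides no minimal generator of `in(I)` means that `E(I)` is saturated in `i`: if `α + e_i ∈ E(I)`
then `α ∈ E(I)` (`forall_minimalMonomialGenerators_iff`).

Homogenization does not change this set: `β ∈ E(I^h)` iff `β ∈ E(I)` after forgetting the exponent
of `x_0` (`mem_leadingExponents_homogenizeIdeal_iff`). So `E(I^h)` is always saturated in `x_0`, and
it is saturated in `x_n` iff `E(I)` is; this identifies (d), (e) and (f). The equivalence with (g)
is an argument with normal forms (`initialIdeal_sup_eq_of_isSaturatedIn`,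
`isSaturatedIn_of_initialIdeal_sup_eq`).

*Saturation implies Cohen–Macaulay.* A polynomial supported off `E(J)` stays so after multiplication
by a saturated variable, hence by any polynomial in such variables. If `z`, `w` are normal forms, a
congruence `g(x_n) z ≡ f(x_0) w` modulo `J` is therefore an equality of polynomials, so
`f(x_0), g(x_n)` is a regular sequence modulo `J` because it is one in the polynomial ring. Given a
maximal ideal of the quotient, the Nullstellensatz supplies monic `f`, `g` with `f(x_0)` and
`g(x_n)` in it. The quotient by them is integral over `K`, since `x_i ^ a_n`, for `1 ≤ i < n`, is
congruent to zero or to a monomial in `x_0, x_n`; so the localization has dimension zero modulo this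
sequence (`isCohenMacaulayLocalRing_localization_of_isWeaklyRegular`). For `in(I)` the sequence
`g(x_n)` does the same.

*Cohen–Macaulay implies saturation.* Only the localization at the origin is needed. In a local ring
with a regular sequence of length two and a regular element `x`, the quotient by `x` has positive
depth (`mem_span_of_forall_pow_mul_mem_span`). With `x = x_0`, and as `x_n` is a parameter modulo
`x_0`, this makes `x_n` a nonzerodivisor on homogeneous elements modulo `(x_0) + J`, both for
`J = I^h` and for `J = in(I^h)`. A homogeneous `f ∈ J` with initial monomial divisible by `x_n` but
not by `x_0` is divisible by `x_n` modulo `x_0`, by the nature of the reverse lexicographic order;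
cancelling `x_n` gives saturation (`isSaturatedIn_of_isCohenMacaulayIdeal`). The dimension of the
localization is bounded below because no power of `x_n` is an initial monomial
(`single_last_notMem_leadingExponents_monomialCurveIdeal`).
-/

open MvPolynomial

/-! ### Leading exponents and initial ideals -/

section LeadingExponents

variable {σ K : Type*} [Field K] (m : MonomialOrder σ)

/-- The exponents of the initial monomials of the nonzero elements of `I`. -/
def leadingExponents (I : Ideal (MvPolynomial σ K)) : Set (σ →₀ ℕ) :=
  {α | ∃ f ∈ I, f ≠ 0 ∧ m.degree f = α}

/-- A set `E` of exponents is saturated in the variable `i` if a monomial lies in `E` as soon as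
its product with `X i` does. For the exponents of a monomial ideal `J`, this says that `X i` is a
nonzerodivisor modulo `J`. -/
def IsSaturatedIn (E : Set (σ →₀ ℕ)) (i : σ) : Prop :=
  ∀ α, α + Finsupp.single i 1 ∈ E → α ∈ E

variable {m} {I : Ideal (MvPolynomial σ K)}

theorem isUpperSet_leadingExponents : IsUpperSet (leadingExponents m I) := by
  rintro α β hle ⟨f, hf, hf0, rfl⟩
  obtain ⟨γ, rfl⟩ := exists_add_of_le hle
  have h1 : (monomial γ (1 : K)) ≠ 0 := by simp
  refine ⟨f * monomial γ 1, I.mul_mem_right _ hf, mul_ne_zero hf0 h1, ?_⟩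
  classical
  rw [m.degree_mul hf0 h1, m.degree_monomial]
  simp

theorem mem_initialIdeal_iff {f : MvPolynomial σ K} :
    f ∈ initialIdeal m I ↔ ∀ α ∈ f.support, α ∈ leadingExponents m I := by
  have h : initialIdeal m I =
      Ideal.span ((fun α => monomial α (1 : K)) '' leadingExponents m I) := by
    unfold initialIdeal leadingExponents
    congr 1
    ext u
    constructor
    · rintro ⟨f, hf, hf0, rfl⟩
      exact ⟨_, ⟨f, hf, hf0, rfl⟩, rfl⟩
    · rintro ⟨_, ⟨f, hf, hf0, rfl⟩, rfl⟩
      exact ⟨f, hf, hf0, rfl⟩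
  rw [h, mem_ideal_span_monomial_image]
  refine forall₂_congr fun α _ => ⟨?_, fun h => ⟨α, h, le_rfl⟩⟩
  rintro ⟨β, hβ, hle⟩
  exact isUpperSet_leadingExponents hle hβ

theorem monomial_mem_initialIdeal_iff {α : σ →₀ ℕ} :
    monomial α (1 : K) ∈ initialIdeal m I ↔ α ∈ leadingExponents m I := by
  classical
  rw [mem_initialIdeal_iff, support_monomial, if_neg one_ne_zero]
  simp

theorem leadingExponents_initialIdeal :
    leadingExponents m (initialIdeal m I) = leadingExponents m I := by
  ext α
  constructor
  · rintro ⟨f, hf, hf0, rfl⟩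
    exact mem_initialIdeal_iff.1 hf _ (m.degree_mem_support hf0)
  · intro h
    classical
    refine ⟨monomial α 1, monomial_mem_initialIdeal_iff.2 h, by simp, ?_⟩
    rw [m.degree_monomial]
    simp

theorem X_dvd_monomial_one_iff {i : σ} {α : σ →₀ ℕ} :
    X i ∣ monomial α (1 : K) ↔ α i ≠ 0 := by
  rw [X_dvd_monomial]
  simp

theorem forall_minimalMonomialGenerators_iff {i : σ} :
    (∀ u ∈ minimalMonomialGenerators (initialIdeal m I), ¬ X i ∣ u) ↔
      IsSaturatedIn (leadingExponents m I) i := by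
  simp only [minimalMonomialGenerators, monomial_mem_initialIdeal_iff]
  constructor
  · intro h α hα
    obtain ⟨β, hle, hβ⟩ := exists_minimal_le_of_wellFoundedLT
      (fun β => β ∈ leadingExponents m I) _ hα
    have hβi : β i = 0 := by
      by_contra hne
      exact h _ ⟨β, hβ, rfl⟩ (X_dvd_monomial_one_iff.2 hne)
    refine isUpperSet_leadingExponents (fun j => ?_) hβ.prop
    by_cases hj : j = i
    · subst hj; omega
    · simpa [Finsupp.single_apply, Ne.symm hj] using hle j
  · rintro h _ ⟨α, hα, rfl⟩ hdvd
    have hi : Finsupp.single i 1 ≤ α := by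
      rw [Finsupp.single_le_iff]
      exact Nat.one_le_iff_ne_zero.2 (X_dvd_monomial_one_iff.1 hdvd)
    obtain ⟨β, rfl⟩ := exists_add_of_le hi
    rw [add_comm] at hα
    have h2 := hα.le_of_le (h β hα.prop) le_self_add i
    simp at h2

theorem initialIdeal_mono {I J : Ideal (MvPolynomial σ K)} (h : I ≤ J) :
    initialIdeal m I ≤ initialIdeal m J := by
  refine Ideal.span_mono ?_
  rintro _ ⟨f, hf, hf0, rfl⟩
  exact ⟨f, h hf, hf0, rfl⟩

/-! ### Normal forms -/

theorem eq_zero_of_mem_of_support {f : MvPolynomial σ K} (hf : f ∈ I)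
    (h : ∀ α ∈ f.support, α ∉ leadingExponents m I) : f = 0 := by
  by_contra h0
  exact h _ (m.degree_mem_support h0) ⟨f, hf, h0, rfl⟩

variable (m I) in
theorem exists_normalForm (f : MvPolynomial σ K) :
    ∃ r, f - r ∈ I ∧ ∀ α ∈ r.support, α ∉ leadingExponents m I := by
  obtain ⟨g, r, hfr, -, hr⟩ := m.div_set (B := {b | b ∈ I ∧ b ≠ 0})
    (fun b hb => isUnit_iff_ne_zero.2 (m.leadingCoeff_ne_zero_iff.2 hb.2)) f
  refine ⟨r, ?_, ?_⟩
  · rw [hfr, add_sub_cancel_right, Finsupp.linearCombination_apply]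
    exact I.sum_mem fun b _ => I.mul_mem_left _ b.2.1
  · rintro α hα ⟨b, hb, hb0, hdeg⟩
    exact hr α hα b ⟨hb, hb0⟩ hdeg.le

theorem support_X_mul_of_isSaturatedIn {i : σ} (hi : IsSaturatedIn (leadingExponents m I) i)
    {r : MvPolynomial σ K} (hr : ∀ α ∈ r.support, α ∉ leadingExponents m I) :
    ∀ α ∈ (X i * r).support, α ∉ leadingExponents m I := by
  classical
  intro α hα hE
  rw [support_X_mul, Finset.mem_map] at hα
  obtain ⟨β, hβ, rfl⟩ := hα
  refine hr β hβ (hi β ?_)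
  simpa [add_comm] using hE

theorem support_aeval_X_mul_of_isSaturatedIn {i : σ}
    (hi : IsSaturatedIn (leadingExponents m I) i) (p : Polynomial K)
    {r : MvPolynomial σ K} (hr : ∀ α ∈ r.support, α ∉ leadingExponents m I) :
    ∀ α ∈ (Polynomial.aeval (X i) p * r).support, α ∉ leadingExponents m I := by
  classical
  induction p using Polynomial.induction_on' with
  | add p q hp hq =>
    intro α hα
    rw [map_add, add_mul] at hα
    rcases Finset.mem_union.1 (support_add hα) with h | h
    exacts [hp α h, hq α h]
  | monomial n c =>
    rw [Polynomial.aeval_monomial, mul_assoc, algebraMap_eq]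
    intro α hα
    have h2 : ∀ k : ℕ, ∀ α ∈ (X i ^ k * r).support, α ∉ leadingExponents m I := by
      intro k
      induction k with
      | zero => simpa using hr
      | succ k ih =>
        rw [pow_succ', mul_assoc]
        exact support_X_mul_of_isSaturatedIn hi ih
    exact h2 n α (mem_support_iff.2 fun h0 => by
      rw [mem_support_iff, coeff_C_mul, h0, mul_zero] at hα
      exact hα rfl)

theorem aeval_X_ne_zero (i : σ) {p : Polynomial K} (hp : p ≠ 0) :
    Polynomial.aeval (X i : MvPolynomial σ K) p ≠ 0 :=
  fun h => hp ((transcendental_iff.1 (transcendental_X (R := K) i)) p h)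

/-- If `X i` does not divide the minimal generators of the initial ideal, then no nonzero
polynomial in `X i` is a zerodivisor modulo `I`: multiplication by it preserves normal forms. -/
theorem mem_of_aeval_X_mul_mem {i : σ} (hi : IsSaturatedIn (leadingExponents m I) i)
    {p : Polynomial K} (hp : p ≠ 0) {z : MvPolynomial σ K}
    (h : Polynomial.aeval (X i) p * z ∈ I) : z ∈ I := by
  obtain ⟨r, hr, hrs⟩ := exists_normalForm m I z
  have h1 : Polynomial.aeval (X i) p * r ∈ I := by
    have := I.sub_mem h (I.mul_mem_left (Polynomial.aeval (X i) p) hr)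
    rwa [mul_sub, sub_sub_cancel] at this
  have h2 := eq_zero_of_mem_of_support h1 (support_aeval_X_mul_of_isSaturatedIn hi p hrs)
  have h3 : r = 0 := (mul_eq_zero.1 h2).resolve_left (aeval_X_ne_zero i hp)
  simpa [h3] using hr

end LeadingExponents

section TwoVariables

variable {K : Type*} [Field K] {n : ℕ}

/-- A monic polynomial in `X 0` is regular modulo a nonzero polynomial in another variable. -/
theorem aeval_X_zero_dvd_of_dvd_mul {p q : Polynomial K} (hp : p.Monic) (hq : q ≠ 0) (j : Fin n)
    {z : MvPolynomial (Fin (n + 1)) K}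
    (h : Polynomial.aeval (X 0) p ∣ Polynomial.aeval (X j.succ) q * z) :
    Polynomial.aeval (X 0) p ∣ z := by
  have e1 : finSuccEquiv K n (Polynomial.aeval (X 0) p) = p.map C := by
    rw [← Polynomial.aeval_algHom_apply, finSuccEquiv_X_zero, ← algebraMap_eq,
      Polynomial.aeval_X_left_eq_map]
  have e2 : finSuccEquiv K n (Polynomial.aeval (X j.succ) q) =
      Polynomial.C (Polynomial.aeval (X j) q) := by
    rw [← Polynomial.aeval_algHom_apply, finSuccEquiv_X_succ]
    exact Polynomial.aeval_algHom_apply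
      ((Algebra.ofId (MvPolynomial (Fin n) K) (Polynomial (MvPolynomial (Fin n) K))).restrictScalars
        K) (X j) q
  have hp' : (p.map (C : K →+* MvPolynomial (Fin n) K)).Monic := hp.map _
  rw [← map_dvd_iff (finSuccEquiv K n), map_mul, e1, e2,
    ← Polynomial.modByMonic_eq_zero_iff_dvd hp', ← Polynomial.smul_eq_C_mul,
    Polynomial.smul_modByMonic] at h
  rw [← map_dvd_iff (finSuccEquiv K n), e1, ← Polynomial.modByMonic_eq_zero_iff_dvd hp']
  exact (smul_eq_zero.1 h).resolve_left (aeval_X_ne_zero j hq)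

/-- If `X 0` and `X j`, `j ≠ 0`, do not divide the minimal generators of the initial ideal, then
`p(X 0), q(X j)` is a regular sequence modulo `J`: for normal forms `z` and `w`, the congruence
`q(X j) z = p(X 0) w` modulo `J` is an equality of polynomials. -/
theorem mem_sup_of_aeval_X_mul_mem_sup {m : MonomialOrder (Fin (n + 1))}
    {J : Ideal (MvPolynomial (Fin (n + 1)) K)} {j : Fin n}
    (h0 : IsSaturatedIn (leadingExponents m J) 0)
    (hj : IsSaturatedIn (leadingExponents m J) j.succ)
    {p q : Polynomial K} (hp : p.Monic) (hq : q ≠ 0) {z : MvPolynomial (Fin (n + 1)) K}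
    (h : Polynomial.aeval (X j.succ) q * z ∈ Ideal.span {Polynomial.aeval (X 0) p} ⊔ J) :
    z ∈ Ideal.span {Polynomial.aeval (X 0) p} ⊔ J := by
  classical
  obtain ⟨u, hu, v, hv, huv⟩ := Submodule.mem_sup.1 h
  obtain ⟨w, rfl⟩ := Ideal.mem_span_singleton'.1 hu
  obtain ⟨z', hz, hzs⟩ := exists_normalForm m J z
  obtain ⟨w', hw, hws⟩ := exists_normalForm m J w
  set P := Polynomial.aeval (X 0 : MvPolynomial (Fin (n + 1)) K) p
  set Q := Polynomial.aeval (X j.succ : MvPolynomial (Fin (n + 1)) K) q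
  have hmem : Q * z' - P * w' ∈ J := by
    have h1 := J.add_mem (J.sub_mem hv (J.mul_mem_left Q hz)) (J.mul_mem_left P hw)
    convert h1 using 1
    linear_combination -huv
  have heq := eq_zero_of_mem_of_support hmem (fun α hα => by
    rcases Finset.mem_union.1 (support_sub _ _ _ hα) with h | h
    exacts [support_aeval_X_mul_of_isSaturatedIn hj q hzs α h,
      support_aeval_X_mul_of_isSaturatedIn h0 p hws α h])
  obtain ⟨t, ht⟩ := aeval_X_zero_dvd_of_dvd_mul hp hq j (z := z')
    ⟨w', sub_eq_zero.1 heq⟩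
  rw [← sub_add_cancel z z']
  exact Ideal.add_mem _ (Ideal.mem_sup_right hz) (Ideal.mem_sup_left
    (Ideal.mem_span_singleton.2 ⟨t, ht⟩))

end TwoVariables

/-! ### Regular sequences and Cohen–Macaulay local rings -/

section LocalAlgebra

open RingTheory.Sequence IsLocalRing
open scoped Pointwise

variable {R : Type*} [CommRing R]

theorem isSMulRegular_self_iff {x : R} : IsSMulRegular R x ↔ ∀ z, x * z = 0 → z = 0 :=
  isSMulRegular_iff_right_eq_zero_of_smul

theorem isWeaklyRegular_cons_cons_iff {x y : R} {rs : List R} :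
    IsWeaklyRegular R (x :: y :: rs) ↔
      (∀ z, x * z = 0 → z = 0) ∧ (∀ z, y * z ∈ Ideal.span {x} → z ∈ Ideal.span {x}) ∧
        IsWeaklyRegular (QuotSMulTop y (QuotSMulTop x R)) rs := by
  rw [isWeaklyRegular_cons_iff, isWeaklyRegular_cons_iff, isSMulRegular_self_iff]
  refine and_congr Iff.rfl (and_congr ?_ Iff.rfl)
  have h : (x • ⊤ : Submodule R R) = Ideal.span {x} := by
    rw [← Submodule.ideal_span_singleton_smul]
    simp
  unfold QuotSMulTop
  rw [h]
  exact isSMulRegular_quotient_iff_mem_of_smul_mem _ _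

/-- If a weakly regular sequence in a prime `p` generates an ideal that lies only in maximal
primes, then the localization at `p` is Cohen–Macaulay: modulo the sequence it has dimension
zero. -/
theorem isCohenMacaulayLocalRing_localization_of_isWeaklyRegular [IsNoetherianRing R]
    (p : Ideal R) [p.IsPrime] {rs : List R} (hrs : ∀ r ∈ rs, r ∈ p) (hreg : IsWeaklyRegular R rs)
    (hmax : ∀ q : Ideal R, q.IsPrime → (∀ r ∈ rs, r ∈ q) → q.IsMaximal) :
    IsCohenMacaulayLocalRing (Localization.AtPrime p) := by
  have : IsNoetherianRing (Localization.AtPrime p) :=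
    IsLocalization.isNoetherianRing p.primeCompl _ inferInstance
  set rs' := rs.map (algebraMap R (Localization.AtPrime p)) with hrs'
  have hreg' : IsRegular (Localization.AtPrime p) rs' :=
    hreg.isRegular_of_isLocalization_of_mem (Localization.AtPrime p) p hrs
  have hmem : ∀ r ∈ rs', r ∈ maximalIdeal (Localization.AtPrime p) := by
    intro r hr
    obtain ⟨s, hs, rfl⟩ := List.mem_map.1 hr
    exact (IsLocalization.AtPrime.to_map_mem_maximal_iff _ p s).2 (hrs s hs)
  refine ⟨this, rs', hmem, hreg', ?_⟩
  have hle : Ideal.ofList rs' ≤ maximalIdeal (Localization.AtPrime p) :=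
    Ideal.span_le.2 hmem
  have hnt : Nontrivial (Localization.AtPrime p ⧸ Ideal.ofList rs') :=
    Ideal.Quotient.nontrivial_iff.2 (ne_top_of_le_ne_top Ideal.IsPrime.ne_top' hle)
  have h0 : Ring.KrullDimLE 0 (Localization.AtPrime p ⧸ Ideal.ofList rs') := by
    rw [Ideal.krullDimLE_zero_quotient_iff_forall_minimalPrimes_isMaximal]
    intro Q hQ
    have hQp : Q.IsPrime := hQ.1.1
    have hcomap : Q.comap (algebraMap R (Localization.AtPrime p)) = p := by
      have hm := hmax (Q.comap (algebraMap R _)) (Ideal.IsPrime.comap _) (fun r hr =>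
        hQ.1.2 (Ideal.subset_span (List.mem_map_of_mem hr)))
      refine hm.eq_of_le Ideal.IsPrime.ne_top' fun r hr => ?_
      exact (IsLocalization.AtPrime.to_map_mem_maximal_iff _ p r).1
        (le_maximalIdeal hQp.ne_top hr)
    have hQmax : Q = maximalIdeal (Localization.AtPrime p) := by
      refine le_antisymm (le_maximalIdeal hQp.ne_top) ?_
      rw [← Localization.AtPrime.map_eq_maximalIdeal, Ideal.map_le_iff_le_comap, hcomap]
    rw [hQmax]
    infer_instance
  have h1 := ringKrullDim_add_length_eq_ringKrullDim_of_isRegular rs' hreg'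
  rwa [ringKrullDimZero_iff_ringKrullDim_eq_zero.1 h0, zero_add] at h1

theorem eq_zero_of_forall_pow_mul_eq_zero {r z : R} (hr : ∀ z, r * z = 0 → z = 0)
    {k : ℕ} (h : r ^ k * z = 0) : z = 0 := by
  induction k with
  | zero => simpa using h
  | succ k ih => exact ih (hr _ (by rw [← mul_assoc, ← pow_succ', h]))

/-- If `r₁, r₂` is weakly regular and `x` is regular, then no element outside `(x)` is multiplied
into `(x)` by both `r₁` and `r₂`. -/
theorem mem_span_of_mul_mem_span_of_isWeaklyRegular {r₁ r₂ x z : R}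
    (h₁ : ∀ z, r₁ * z = 0 → z = 0) (h₂ : ∀ z, r₂ * z ∈ Ideal.span {r₁} → z ∈ Ideal.span {r₁})
    (hx : ∀ z, x * z = 0 → z = 0) (hz₁ : r₁ * z ∈ Ideal.span {x})
    (hz₂ : r₂ * z ∈ Ideal.span {x}) : z ∈ Ideal.span {x} := by
  obtain ⟨w, hw⟩ := Ideal.mem_span_singleton'.1 hz₁
  obtain ⟨v, hv⟩ := Ideal.mem_span_singleton'.1 hz₂
  -- `x (r₂ w) = r₁ r₂ z = x (r₁ v)`, hence `r₂ w = r₁ v`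
  have h3 : r₂ * w - r₁ * v = 0 := hx _ (by linear_combination r₂ * hw - r₁ * hv)
  obtain ⟨u, hu⟩ := Ideal.mem_span_singleton'.1
    (h₂ w (Ideal.mem_span_singleton'.2 ⟨v, by linear_combination -h3⟩))
  have h4 : z - u * x = 0 := h₁ _ (by rw [← hu] at hw; linear_combination -hw)
  exact Ideal.mem_span_singleton'.2 ⟨u, (sub_eq_zero.1 h4).symm⟩

/-- In a ring with a weakly regular sequence of length two in an ideal `𝔪`, an element that a
power of `𝔪` multiplies into a principal ideal generated by a regular element lies in that
ideal. -/
theorem mem_span_of_forall_pow_mul_mem_span {r₁ r₂ x : R} {𝔪 : Ideal R}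
    (hr₁ : r₁ ∈ 𝔪) (hr₂ : r₂ ∈ 𝔪)
    (h₁ : ∀ z, r₁ * z = 0 → z = 0) (h₂ : ∀ z, r₂ * z ∈ Ideal.span {r₁} → z ∈ Ideal.span {r₁})
    (hx : ∀ z, x * z = 0 → z = 0) (k : ℕ) {z : R} (h : ∀ s ∈ 𝔪 ^ k, s * z ∈ Ideal.span {x}) :
    z ∈ Ideal.span {x} := by
  induction k generalizing z with
  | zero => simpa using h 1 (by simp)
  | succ k ih =>
    have key : ∀ r ∈ 𝔪, r * z ∈ Ideal.span {x} := fun r hr => ih fun s hs => by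
      rw [← mul_assoc]
      exact h _ (by rw [pow_succ]; exact Ideal.mul_mem_mul hs hr)
    exact mem_span_of_mul_mem_span_of_isWeaklyRegular h₁ h₂ hx (key _ hr₁) (key _ hr₂)

theorem one_le_ringKrullDim_of_not_isNilpotent [IsLocalRing R] {x : R} (hx : x ∈ maximalIdeal R)
    (hn : ¬ IsNilpotent x) : 1 ≤ ringKrullDim R := by
  by_contra h
  have h0 : ringKrullDim R ≤ (0 : ℕ) := by
    rw [not_le] at h
    exact ENat.WithBot.lt_add_one_iff.1 (by simpa using h)
  have : Ring.KrullDimLE 0 R := (Ring.krullDimLE_iff).2 h0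
  exact hn (Ring.KrullDimLE.isNilpotent_iff_mem_maximalIdeal.2 hx)

/-- A Cohen–Macaulay local ring in which some element of the maximal ideal is not nilpotent has
positive depth: no nonzero element is killed by a power of the maximal ideal. -/
theorem IsCohenMacaulayLocalRing.eq_zero_of_forall_pow_mul_eq_zero [IsLocalRing R]
    (hR : IsCohenMacaulayLocalRing R) {y : R} (hy : y ∈ maximalIdeal R) (hny : ¬ IsNilpotent y)
    {k : ℕ} {z : R} (h : ∀ s ∈ maximalIdeal R ^ k, s * z = 0) : z = 0 := by
  obtain ⟨-, rs, hmem, hreg, hlen⟩ := hR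
  have hdim := one_le_ringKrullDim_of_not_isNilpotent hy hny
  rw [← hlen] at hdim
  match rs, hmem, hreg, hdim with
  | [], _, _, hdim => exact absurd hdim (by simp)
  | r :: rs, hmem, hreg, _ =>
    have hr := isSMulRegular_self_iff.1 ((isWeaklyRegular_cons_iff R r rs).1 hreg.1).1
    exact _root_.eq_zero_of_forall_pow_mul_eq_zero hr
      (h _ (Ideal.pow_mem_pow (hmem r (by simp)) k))

/-- In a Cohen–Macaulay local ring of dimension at least two (certified by a regular element `x`
and an element that is not nilpotent modulo `x`), the quotient by `x` has positive depth. -/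
theorem IsCohenMacaulayLocalRing.mem_span_of_forall_pow_mul_mem_span [IsLocalRing R]
    (hR : IsCohenMacaulayLocalRing R) {x y : R} (hx : x ∈ maximalIdeal R)
    (hxreg : ∀ z, x * z = 0 → z = 0) (hy : y ∈ maximalIdeal R)
    (hny : ∀ k : ℕ, y ^ k ∉ Ideal.span {x})
    {k : ℕ} {z : R} (h : ∀ s ∈ maximalIdeal R ^ k, s * z ∈ Ideal.span {x}) :
    z ∈ Ideal.span {x} := by
  obtain ⟨hN, rs, hmem, hreg, hlen⟩ := hR
  have hdim : 2 ≤ ringKrullDim R := by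
    have hle : Ideal.span {x} ≤ maximalIdeal R :=
      (Ideal.span_singleton_le_iff_mem _).2 hx
    have hnt : Nontrivial (R ⧸ Ideal.span {x}) :=
      Ideal.Quotient.nontrivial_iff.2 (ne_top_of_le_ne_top Ideal.IsPrime.ne_top' hle)
    have hloc : IsLocalRing (R ⧸ Ideal.span {x}) :=
      IsLocalRing.of_surjective' (Ideal.Quotient.mk _) Ideal.Quotient.mk_surjective
    have h1 : 1 ≤ ringKrullDim (R ⧸ Ideal.span {x}) := by
      refine one_le_ringKrullDim_of_not_isNilpotent (x := Ideal.Quotient.mk _ y) ?_ ?_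
      · have := IsLocalHom.of_surjective (Ideal.Quotient.mk (Ideal.span {x}))
          Ideal.Quotient.mk_surjective
        exact map_mem_nonunits_iff _ _ |>.2 hy
      · rintro ⟨k, hk⟩
        rw [← map_pow, Ideal.Quotient.eq_zero_iff_mem] at hk
        exact hny k hk
    rw [← ringKrullDim_quotient_span_singleton_succ_eq_ringKrullDim
      (isSMulRegular_self_iff.2 hxreg) hx]
    calc (2 : WithBot ℕ∞) = 1 + 1 := by norm_num
      _ ≤ _ := by gcongr
  rw [← hlen] at hdim
  match rs, hmem, hreg, hdim with
  | [], _, _, hdim => exact absurd hdim (by simp)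
  | [r], _, _, hdim => exact absurd hdim (by simp)
  | r₁ :: r₂ :: rs, hmem, hreg, _ =>
    obtain ⟨h₁, h₂, -⟩ := isWeaklyRegular_cons_cons_iff.1 hreg.1
    exact _root_.mem_span_of_forall_pow_mul_mem_span (hmem r₁ (by simp)) (hmem r₂ (by simp))
      h₁ h₂ hxreg k h

end LocalAlgebra

/-! ### Cohen–Macaulayness from saturated leading exponents -/

section Sufficiency

open RingTheory.Sequence

variable {σ K : Type*} [Field K]

/-- A form of the Nullstellensatz: modulo a maximal ideal, every variable is algebraic. -/
theorem exists_monic_aeval_X_mem [Finite σ] (M : Ideal (MvPolynomial σ K)) [M.IsMaximal] (i : σ) :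
    ∃ f : Polynomial K, f.Monic ∧ Polynomial.aeval (X i : MvPolynomial σ K) f ∈ M := by
  let := Ideal.Quotient.field M
  have : Module.Finite K (MvPolynomial σ K ⧸ M) :=
    finite_of_finite_type_of_isJacobsonRing K (MvPolynomial σ K ⧸ M)
  obtain ⟨f, hf, h⟩ := Algebra.IsIntegral.isIntegral (R := K) (Ideal.Quotient.mk M (X i))
  refine ⟨f, hf, Ideal.Quotient.eq_zero_iff_mem.1 ?_⟩
  rw [← h]
  exact (Polynomial.aeval_algHom_apply (Ideal.Quotient.mkₐ K M) (X i) f).symm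

theorem isMaximal_of_forall_isIntegral (Q : Ideal (MvPolynomial σ K)) [Q.IsPrime]
    (h : ∀ i, IsIntegral K (Ideal.Quotient.mk Q (X i))) : Q.IsMaximal := by
  have hint : Algebra.IsIntegral K (MvPolynomial σ K ⧸ Q) := by
    refine ⟨fun z => ?_⟩
    obtain ⟨f, rfl⟩ := Ideal.Quotient.mk_surjective z
    induction f using MvPolynomial.induction_on with
    | C c => exact isIntegral_algebraMap (R := K) (A := MvPolynomial σ K ⧸ Q) (x := c)
    | add f g hf hg => rw [map_add]; exact hf.add hg
    | mul_X f i hf => rw [map_mul]; exact hf.mul (h i)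
  exact Ideal.Quotient.maximal_of_isField _
    (isField_of_isIntegral_of_isField' (R := K) (Field.toIsField K))

theorem isMaximal_of_aeval_X_mem (Q : Ideal (MvPolynomial σ K)) [Q.IsPrime] (T : Set σ)
    (hT : ∀ i ∈ T, ∃ f : Polynomial K, f.Monic ∧ Polynomial.aeval (X i : MvPolynomial σ K) f ∈ Q)
    (hrel : ∀ i, ∃ k > 0, ∃ h ∈ Algebra.adjoin K (X '' T : Set (MvPolynomial σ K)),
      X i ^ k - h ∈ Q) : Q.IsMaximal := by
  refine isMaximal_of_forall_isIntegral Q fun i => ?_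
  obtain ⟨k, hk, h, hh, hmem⟩ := hrel i
  refine IsIntegral.of_pow hk ?_
  rw [← map_pow, Ideal.Quotient.eq.2 hmem]
  have hle : Algebra.adjoin K (X '' T : Set (MvPolynomial σ K)) ≤
      (integralClosure K (MvPolynomial σ K ⧸ Q)).comap (Ideal.Quotient.mkₐ K Q) := by
    refine Algebra.adjoin_le ?_
    rintro _ ⟨j, hj, rfl⟩
    obtain ⟨f, hf, hfQ⟩ := hT j hj
    refine ⟨f, hf, ?_⟩
    have h1 := Polynomial.aeval_algHom_apply (Ideal.Quotient.mkₐ K Q) (X j) f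
    rw [Ideal.Quotient.mkₐ_eq_mk, Ideal.Quotient.eq_zero_iff_mem.2 hfQ] at h1
    exact h1
  exact hle hh

theorem mk_mem_span_singleton_mk_iff {R : Type*} [CommRing R] {J : Ideal R} {x z : R} :
    Ideal.Quotient.mk J z ∈ Ideal.span {Ideal.Quotient.mk J x} ↔ z ∈ Ideal.span {x} ⊔ J := by
  rw [← Set.image_singleton, ← Ideal.map_span, Ideal.mem_quotient_iff_mem_sup]

/-- The quotient by `J` is Cohen–Macaulay if it is integral over the subalgebra generated by the
variables in the list `l`, and any choice of one monic polynomial in each of these variables is a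
weakly regular sequence modulo `J`. -/
theorem isCohenMacaulayIdeal_of_isWeaklyRegular [Finite σ] {J : Ideal (MvPolynomial σ K)}
    (l : List σ)
    (hreg : ∀ f : σ → Polynomial K, (∀ i, (f i).Monic) → IsWeaklyRegular (MvPolynomial σ K ⧸ J)
      (l.map fun i => Ideal.Quotient.mk J (Polynomial.aeval (X i) (f i))))
    (hrel : ∀ i, ∃ k > 0, ∃ h ∈ Algebra.adjoin K (X '' {i | i ∈ l} : Set (MvPolynomial σ K)),
      X i ^ k - h ∈ J) : IsCohenMacaulayIdeal J := by
  refine ⟨inferInstance, fun p hp => ?_⟩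
  have hM : (p.comap (Ideal.Quotient.mk J)).IsMaximal :=
    Ideal.comap_isMaximal_of_surjective _ Ideal.Quotient.mk_surjective
  choose f hf hfp using exists_monic_aeval_X_mem (p.comap (Ideal.Quotient.mk J))
  refine isCohenMacaulayLocalRing_localization_of_isWeaklyRegular p
    (rs := l.map fun i => Ideal.Quotient.mk J (Polynomial.aeval (X i) (f i))) ?_ (hreg f hf) ?_
  · intro r hr
    obtain ⟨i, -, rfl⟩ := List.mem_map.1 hr
    exact hfp i
  · intro q hq hqr
    have hmax : (q.comap (Ideal.Quotient.mk J)).IsMaximal := by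
      refine isMaximal_of_aeval_X_mem _ {i | i ∈ l} (fun i hi => ⟨f i, hf i, ?_⟩) fun i => ?_
      · exact hqr _ (List.mem_map.2 ⟨i, hi, rfl⟩)
      · obtain ⟨k, hk, h, hh, hmem⟩ := hrel i
        refine ⟨k, hk, h, hh, ?_⟩
        rw [Ideal.mem_comap, Ideal.Quotient.eq_zero_iff_mem.2 hmem]
        exact q.zero_mem
    rw [← Ideal.map_comap_of_surjective _ Ideal.Quotient.mk_surjective q]
    refine (Ideal.map_eq_top_or_isMaximal_of_surjective _ Ideal.Quotient.mk_surjective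
      hmax).resolve_left fun htop => hq.ne_top ?_
    rwa [Ideal.map_comap_of_surjective _ Ideal.Quotient.mk_surjective] at htop

theorem isCohenMacaulayIdeal_of_isSaturatedIn [Finite σ] {m : MonomialOrder σ}
    {J : Ideal (MvPolynomial σ K)} {i : σ} (hi : IsSaturatedIn (leadingExponents m J) i)
    (hrel : ∀ l, ∃ k > 0, ∃ h ∈ Algebra.adjoin K {(X i : MvPolynomial σ K)}, X l ^ k - h ∈ J) :
    IsCohenMacaulayIdeal J := by
  refine isCohenMacaulayIdeal_of_isWeaklyRegular [i] (fun f hf => ?_) (by simpa using hrel)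
  rw [List.map_singleton, isWeaklyRegular_singleton_iff, isSMulRegular_self_iff]
  intro z hz
  obtain ⟨z, rfl⟩ := Ideal.Quotient.mk_surjective z
  rw [← map_mul, Ideal.Quotient.eq_zero_iff_mem] at hz
  exact Ideal.Quotient.eq_zero_iff_mem.2 (mem_of_aeval_X_mul_mem hi (hf i).ne_zero hz)

theorem isCohenMacaulayIdeal_of_isSaturatedIn_zero_of_isSaturatedIn_succ {n : ℕ}
    {m : MonomialOrder (Fin (n + 1))} {J : Ideal (MvPolynomial (Fin (n + 1)) K)} {j : Fin n}
    (h0 : IsSaturatedIn (leadingExponents m J) 0)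
    (hj : IsSaturatedIn (leadingExponents m J) j.succ)
    (hrel : ∀ l, ∃ k > 0, ∃ h ∈ Algebra.adjoin K {(X 0 : MvPolynomial (Fin (n + 1)) K), X j.succ},
      X l ^ k - h ∈ J) :
    IsCohenMacaulayIdeal J := by
  refine isCohenMacaulayIdeal_of_isWeaklyRegular [0, j.succ] (fun f hf => ?_) ?_
  · rw [List.map_cons, List.map_singleton, isWeaklyRegular_cons_cons_iff]
    refine ⟨fun z hz => ?_, fun z hz => ?_, IsWeaklyRegular.nil _ _⟩
    · obtain ⟨z, rfl⟩ := Ideal.Quotient.mk_surjective z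
      rw [← map_mul, Ideal.Quotient.eq_zero_iff_mem] at hz
      exact Ideal.Quotient.eq_zero_iff_mem.2 (mem_of_aeval_X_mul_mem h0 (hf 0).ne_zero hz)
    · obtain ⟨z, rfl⟩ := Ideal.Quotient.mk_surjective z
      rw [← map_mul, mk_mem_span_singleton_mk_iff] at hz
      exact mk_mem_span_singleton_mk_iff.2
        (mem_sup_of_aeval_X_mul_mem_sup h0 hj (hf 0) (hf j.succ).ne_zero hz)
  · have h : (X '' {i | i ∈ [0, j.succ]} : Set (MvPolynomial (Fin (n + 1)) K)) =
        {X 0, X j.succ} := by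
      ext u
      simp [eq_comm]
    rwa [h]

end Sufficiency

/-! ### Consequences of Cohen–Macaulayness at the origin -/

section LocalizationAtOrigin

attribute [local instance] MvPolynomial.gradedAlgebra

variable {σ K : Type*} [Field K]

theorem homogeneousComponent_mul_of_isHomogeneous (s : MvPolynomial σ K) {z : MvPolynomial σ K}
    {d : ℕ} (hz : z.IsHomogeneous d) :
    homogeneousComponent d (s * z) = C (constantCoeff s) * z := by
  have h := DirectSum.coe_decompose_mul_add_of_right_mem (homogeneousSubmodule σ K)
    (i := 0) (a := s) ((mem_homogeneousSubmodule d z).2 hz)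
  rw [zero_add] at h
  rw [constantCoeff_eq, ← homogeneousComponent_zero, ← decomposition.decompose'_apply,
    ← decomposition.decompose'_apply]
  exact h

/-- A homogeneous ideal is saturated, on homogeneous elements, with respect to polynomials that do
not vanish at the origin. -/
theorem mem_of_mul_mem_of_constantCoeff_ne_zero {L : Ideal (MvPolynomial σ K)}
    (hL : L.IsHomogeneous (homogeneousSubmodule σ K)) {s z : MvPolynomial σ K} {d : ℕ}
    (hz : z.IsHomogeneous d) (hs : constantCoeff s ≠ 0) (h : s * z ∈ L) : z ∈ L := by
  have h1 := homogeneousComponent_mem_of_mem hL h d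
  rw [homogeneousComponent_mul_of_isHomogeneous s hz] at h1
  have h2 := L.mul_mem_left (C (constantCoeff s)⁻¹) h1
  rwa [← mul_assoc, ← C_mul, inv_mul_cancel₀ hs, C_1, one_mul] at h2

theorem le_ker_constantCoeff {L : Ideal (MvPolynomial σ K)}
    (hL : L.IsHomogeneous (homogeneousSubmodule σ K)) (hne : L ≠ ⊤) :
    L ≤ RingHom.ker (constantCoeff (σ := σ) (R := K)) := by
  intro f hf
  by_contra h
  refine hne ((Ideal.eq_top_iff_one _).2 ?_)
  exact mem_of_mul_mem_of_constantCoeff_ne_zero hL (isHomogeneous_one σ K) h (by simpa using hf)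

theorem ker_constantCoeff_eq_idealOfVars :
    RingHom.ker (constantCoeff (σ := σ) (R := K)) = idealOfVars σ K := by
  ext f
  rw [RingHom.mem_ker, ← pow_one (idealOfVars σ K), mem_pow_idealOfVars_iff', constantCoeff_eq]
  refine ⟨fun h x hx => ?_, fun h => h 0 (by simp)⟩
  rw [(Finsupp.degree_eq_zero_iff x).1 (by omega), h]

instance isMaximal_idealOfVars : (idealOfVars σ K).IsMaximal := by
  rw [← ker_constantCoeff_eq_idealOfVars]
  exact RingHom.ker_isMaximal_of_surjective _ fun c => ⟨C c, constantCoeff_C _ c⟩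

/-- The irrelevant maximal ideal of a quotient of the polynomial ring. -/
noncomputable abbrev irrelevantIdeal (J : Ideal (MvPolynomial σ K)) :
    Ideal (MvPolynomial σ K ⧸ J) :=
  (idealOfVars σ K).map (Ideal.Quotient.mk J)

variable {J : Ideal (MvPolynomial σ K)}

theorem comap_irrelevantIdeal (hJ : J ≤ idealOfVars σ K) :
    (irrelevantIdeal J).comap (Ideal.Quotient.mk J) = idealOfVars σ K := by
  rw [Ideal.comap_map_of_surjective' _ Ideal.Quotient.mk_surjective, Ideal.mk_ker,
    sup_eq_left.2 hJ]

theorem isMaximal_irrelevantIdeal (hJ : J ≤ idealOfVars σ K) : (irrelevantIdeal J).IsMaximal := by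
  refine (Ideal.map_eq_top_or_isMaximal_of_surjective _ Ideal.Quotient.mk_surjective
    inferInstance).resolve_left fun h => ?_
  have := comap_irrelevantIdeal hJ
  rw [irrelevantIdeal, h, Ideal.comap_top] at this
  exact isMaximal_idealOfVars.ne_top this.symm

theorem mk_mem_irrelevantIdeal_iff (hJ : J ≤ idealOfVars σ K) {s : MvPolynomial σ K} :
    Ideal.Quotient.mk J s ∈ irrelevantIdeal J ↔ constantCoeff s = 0 := by
  rw [← Ideal.mem_comap, comap_irrelevantIdeal hJ, ← ker_constantCoeff_eq_idealOfVars,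
    RingHom.mem_ker]

variable [(irrelevantIdeal J).IsPrime]

/-- The canonical map from the polynomial ring to the localization of its quotient by `J` at the
origin. -/
noncomputable def toLocalizationAtOrigin (J : Ideal (MvPolynomial σ K))
    [(irrelevantIdeal J).IsPrime] :
    MvPolynomial σ K →+* Localization.AtPrime (irrelevantIdeal J) :=
  (algebraMap _ _).comp (Ideal.Quotient.mk J)

theorem exists_mul_mem_of_toLocalizationAtOrigin_mem (hJ : J ≤ idealOfVars σ K)
    {x z : MvPolynomial σ K}
    (h : toLocalizationAtOrigin J z ∈ Ideal.span {toLocalizationAtOrigin J x}) :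
    ∃ s, constantCoeff s ≠ 0 ∧ s * z ∈ Ideal.span {x} ⊔ J := by
  have h1 : toLocalizationAtOrigin J z ∈ (Ideal.span {Ideal.Quotient.mk J x}).map
      (algebraMap _ (Localization.AtPrime (irrelevantIdeal J))) := by
    rwa [Ideal.map_span, Set.image_singleton]
  obtain ⟨⟨⟨u, hu⟩, t⟩, ht⟩ :=
    (IsLocalization.mem_map_algebraMap_iff (irrelevantIdeal J).primeCompl _).1 h1
  rw [toLocalizationAtOrigin, RingHom.comp_apply, ← map_mul] at ht
  obtain ⟨c, hc⟩ := (IsLocalization.eq_iff_exists (irrelevantIdeal J).primeCompl _).1 ht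
  obtain ⟨s, hs⟩ := Ideal.Quotient.mk_surjective
    ((c : MvPolynomial σ K ⧸ J) * (t : MvPolynomial σ K ⧸ J))
  refine ⟨s, fun h0 => ?_, ?_⟩
  · exact (c * t).2 (by rw [Submonoid.coe_mul, ← hs]; exact (mk_mem_irrelevantIdeal_iff hJ).2 h0)
  · rw [← mk_mem_span_singleton_mk_iff, map_mul, hs, mul_assoc,
      mul_comm (t : MvPolynomial σ K ⧸ J), hc]
    exact Ideal.mul_mem_left _ _ hu

theorem toLocalizationAtOrigin_mem_span (x : MvPolynomial σ K) {z : MvPolynomial σ K}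
    (h : z ∈ Ideal.span {x} ⊔ J) :
    toLocalizationAtOrigin J z ∈ Ideal.span {toLocalizationAtOrigin J x} := by
  have h1 := Ideal.mem_map_of_mem (algebraMap _ (Localization.AtPrime (irrelevantIdeal J)))
    (mk_mem_span_singleton_mk_iff.2 h)
  rwa [Ideal.map_span, Set.image_singleton] at h1

theorem toLocalizationAtOrigin_mem_maximalIdeal (hJ : J ≤ idealOfVars σ K)
    {z : MvPolynomial σ K} (hz : constantCoeff z = 0) :
    toLocalizationAtOrigin J z ∈
      IsLocalRing.maximalIdeal (Localization.AtPrime (irrelevantIdeal J)) :=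
  (IsLocalization.AtPrime.to_map_mem_maximal_iff _ (irrelevantIdeal J) _).2
    ((mk_mem_irrelevantIdeal_iff hJ).2 hz)

theorem exists_forall_pow_mul_mem [Finite σ] {x y z : MvPolynomial σ K}
    (hpow : ∀ i, ∃ k : ℕ, X i ^ k ∈ Ideal.span {y} ⊔ (Ideal.span {x} ⊔ J))
    (h : y * z ∈ Ideal.span {x} ⊔ J) :
    ∃ k : ℕ, ∀ s ∈ IsLocalRing.maximalIdeal (Localization.AtPrime (irrelevantIdeal J)) ^ k,
      s * toLocalizationAtOrigin J z ∈ Ideal.span {toLocalizationAtOrigin J x} := by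
  set L := Ideal.span {x} ⊔ J
  let A : Ideal (MvPolynomial σ K) := Submodule.comap (LinearMap.mulRight (MvPolynomial σ K) z) L
  have hA : ∀ s, s ∈ A ↔ s * z ∈ L := fun s => Iff.rfl
  have hle : Ideal.span {y} ⊔ L ≤ A := by
    refine sup_le ((Ideal.span_singleton_le_iff_mem _).2 h) fun s hs => ?_
    exact L.mul_mem_right z hs
  obtain ⟨k, hk⟩ := Ideal.exists_pow_le_of_le_radical_of_fg
    (I := idealOfVars σ K) (J := A) (Ideal.span_le.2 (by
      rintro _ ⟨i, rfl⟩
      obtain ⟨k, hk⟩ := hpow i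
      exact ⟨k, hle hk⟩)) (idealOfVars_fg σ K)
  refine ⟨k, fun s hs => ?_⟩
  have hmap : IsLocalRing.maximalIdeal (Localization.AtPrime (irrelevantIdeal J)) ^ k =
      (idealOfVars σ K ^ k).map (toLocalizationAtOrigin J) := by
    rw [← Localization.AtPrime.map_eq_maximalIdeal, Ideal.map_map, Ideal.map_pow]
    rfl
  rw [hmap] at hs
  refine Submodule.span_induction ?_ (by simp) ?_ ?_ hs
  · rintro _ ⟨t, ht, rfl⟩
    rw [← map_mul]
    exact toLocalizationAtOrigin_mem_span x (hk ht)
  · intro u v _ _ hu hv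
    rw [add_mul]
    exact Ideal.add_mem _ hu hv
  · intro c u _ hu
    rw [smul_eq_mul, mul_assoc]
    exact Ideal.mul_mem_left _ _ hu

end LocalizationAtOrigin

section Necessity

attribute [local instance] MvPolynomial.gradedAlgebra

variable {σ K : Type*} [Field K]

/-- If `J` is a homogeneous Cohen–Macaulay ideal of positive dimension for which `X y` is a
parameter, then `X y` kills no nonzero homogeneous element modulo `J`. -/
theorem mem_of_X_mul_mem_of_isCohenMacaulayIdeal [Finite σ] {J : Ideal (MvPolynomial σ K)} {y : σ}
    (hcm : IsCohenMacaulayIdeal J) (hJ : J.IsHomogeneous (homogeneousSubmodule σ K))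
    (hpow : ∀ i, ∃ k : ℕ, X i ^ k ∈ Ideal.span {X y} ⊔ J) (hy : ∀ k : ℕ, X y ^ k ∉ J)
    {z : MvPolynomial σ K} {d : ℕ} (hz : z.IsHomogeneous d) (h : X y * z ∈ J) : z ∈ J := by
  have hle : J ≤ idealOfVars σ K := by
    rw [← ker_constantCoeff_eq_idealOfVars]
    refine le_ker_constantCoeff hJ fun htop => hy 0 ?_
    rw [htop]
    exact Submodule.mem_top
  have hmax := isMaximal_irrelevantIdeal hle
  have hloc := hcm.2 (irrelevantIdeal J)
  have hsup : Ideal.span {0} ⊔ J = J := by simp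
  obtain ⟨k, hk⟩ := exists_forall_pow_mul_mem (J := J) (x := 0) (y := X y) (z := z)
    (by rwa [hsup]) (by rwa [hsup])
  have hspan : Ideal.span {toLocalizationAtOrigin J (0 : MvPolynomial σ K)} = ⊥ := by simp
  simp only [hspan, Ideal.mem_bot] at hk
  have hdesc : ∀ {w : MvPolynomial σ K} {e : ℕ}, w.IsHomogeneous e →
      toLocalizationAtOrigin J w = 0 → w ∈ J := by
    intro w e hw h0
    obtain ⟨s, hs, hsw⟩ := exists_mul_mem_of_toLocalizationAtOrigin_mem hle (x := 0) (z := w)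
      (by rw [h0]; exact Ideal.zero_mem _)
    rw [hsup] at hsw
    exact mem_of_mul_mem_of_constantCoeff_ne_zero hJ hw hs hsw
  refine hdesc hz (hloc.eq_zero_of_forall_pow_mul_eq_zero (y := toLocalizationAtOrigin J (X y))
    (toLocalizationAtOrigin_mem_maximalIdeal hle (constantCoeff_X _ y)) ?_ hk)
  rintro ⟨l, hl⟩
  rw [← map_pow] at hl
  exact hy l (hdesc (isHomogeneous_X_pow y l) hl)

/-- If `J` is a homogeneous Cohen–Macaulay ideal for which `X x, X y` is a system of parameters and
`X x` is a nonzerodivisor modulo `J`, then `X y` kills no nonzero homogeneous element modulo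
`(X x) + J`. -/
theorem mem_sup_of_X_mul_mem_sup_of_isCohenMacaulayIdeal [Finite σ]
    {J : Ideal (MvPolynomial σ K)} {x y : σ} (hcm : IsCohenMacaulayIdeal J)
    (hL : (Ideal.span {X x} ⊔ J).IsHomogeneous (homogeneousSubmodule σ K))
    (hx : ∀ z, X x * z ∈ J → z ∈ J)
    (hpow : ∀ i, ∃ k : ℕ, X i ^ k ∈ Ideal.span {X y} ⊔ (Ideal.span {X x} ⊔ J))
    (hy : ∀ k : ℕ, X y ^ k ∉ Ideal.span {X x} ⊔ J)
    {z : MvPolynomial σ K} {d : ℕ} (hz : z.IsHomogeneous d) (h : X y * z ∈ Ideal.span {X x} ⊔ J) :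
    z ∈ Ideal.span {X x} ⊔ J := by
  have hle : J ≤ idealOfVars σ K := by
    rw [← ker_constantCoeff_eq_idealOfVars]
    refine le_sup_right.trans (le_ker_constantCoeff hL fun htop => hy 0 ?_)
    rw [htop]
    exact Submodule.mem_top
  have hmax := isMaximal_irrelevantIdeal hle
  have hloc := hcm.2 (irrelevantIdeal J)
  obtain ⟨k, hk⟩ := exists_forall_pow_mul_mem hpow h
  have hdesc : ∀ {w : MvPolynomial σ K} {e : ℕ}, w.IsHomogeneous e →
      toLocalizationAtOrigin J w ∈ Ideal.span {toLocalizationAtOrigin J (X x)} →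
      w ∈ Ideal.span {X x} ⊔ J := by
    intro w e hw h0
    obtain ⟨s, hs, hsw⟩ := exists_mul_mem_of_toLocalizationAtOrigin_mem hle h0
    exact mem_of_mul_mem_of_constantCoeff_ne_zero hL hw hs hsw
  have hxreg : ∀ w, toLocalizationAtOrigin J (X x) * w = 0 → w = 0 := by
    have h1 : RingTheory.Sequence.IsWeaklyRegular (MvPolynomial σ K ⧸ J)
        [Ideal.Quotient.mk J (X x)] := by
      rw [RingTheory.Sequence.isWeaklyRegular_singleton_iff, isSMulRegular_self_iff]
      intro w hw
      obtain ⟨w, rfl⟩ := Ideal.Quotient.mk_surjective w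
      rw [← map_mul, Ideal.Quotient.eq_zero_iff_mem] at hw
      exact Ideal.Quotient.eq_zero_iff_mem.2 (hx w hw)
    have h2 := h1.of_isLocalization (Localization.AtPrime (irrelevantIdeal J))
      (irrelevantIdeal J).primeCompl
    rw [List.map_singleton, RingTheory.Sequence.isWeaklyRegular_singleton_iff,
      isSMulRegular_self_iff] at h2
    exact h2
  refine hdesc hz (hloc.mem_span_of_forall_pow_mul_mem_span
    (toLocalizationAtOrigin_mem_maximalIdeal hle (constantCoeff_X _ x)) hxreg
    (toLocalizationAtOrigin_mem_maximalIdeal hle (constantCoeff_X _ y)) ?_ hk)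
  intro l hl
  rw [← map_pow] at hl
  exact hy l (hdesc (isHomogeneous_X_pow y l) hl)

end Necessity

/-! ### Reverse lexicographic orders and homogeneous ideals -/

section ReverseLexicographic

attribute [local instance] MvPolynomial.gradedAlgebra

variable {σ K : Type*} [Field K]

theorem X_dvd_iff_forall_mem_support {i : σ} {f : MvPolynomial σ K} :
    X i ∣ f ↔ ∀ γ ∈ f.support, γ i ≠ 0 := by
  rw [← Ideal.mem_span_singleton, ← Set.image_singleton (f := X), mem_ideal_span_X_image]
  simp

theorem isHomogeneous_of_X_mul {i : σ} {z : MvPolynomial σ K} {d : ℕ}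
    (h : (X i * z).IsHomogeneous (d + 1)) : z.IsHomogeneous d := by
  intro γ hγ
  have h1 := h (d := γ + Finsupp.single i 1) (by rwa [add_comm, coeff_X_mul])
  rw [map_add, Finsupp.weight_single] at h1
  simpa using h1

theorem isHomogeneous_initialIdeal (m : MonomialOrder σ) (I : Ideal (MvPolynomial σ K)) :
    (initialIdeal m I).IsHomogeneous (homogeneousSubmodule σ K) := by
  refine Ideal.homogeneous_span _ _ ?_
  rintro _ ⟨f, -, -, rfl⟩
  exact ⟨_, isHomogeneous_monomial 1 rfl⟩

open scoped MonomialOrder in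
theorem degree_eq_of_forall_le {m : MonomialOrder σ} {f : MvPolynomial σ K} {β : σ →₀ ℕ}
    (hβ : coeff β f ≠ 0) (h : ∀ γ ∈ f.support, γ ≼[m] β) : m.degree f = β :=
  m.toSyn.injective (le_antisymm (m.degree_le_iff.2 h) (m.le_degree (mem_support_iff.2 hβ)))

theorem IsSaturatedIn.erase_mem {E : Set (σ →₀ ℕ)} {i : σ} (h : IsSaturatedIn E i)
    {β : σ →₀ ℕ} (hβ : β ∈ E) : β.erase i ∈ E := by
  have key : ∀ k : ℕ, β.erase i + Finsupp.single i k ∈ E → β.erase i ∈ E := by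
    intro k
    induction k with
    | zero => simp
    | succ k ih =>
      intro hk
      refine ih (h _ ?_)
      rwa [add_assoc, ← Finsupp.single_add]
  refine key (β i) ?_
  rwa [Finsupp.erase_add_single]

/-- The leading exponents of a homogeneous element come from homogeneous elements. -/
theorem exists_isHomogeneous_of_mem_leadingExponents [Finite σ] {τ : σ ↪ ℕ}
    {J : Ideal (MvPolynomial σ K)} (hJ : J.IsHomogeneous (homogeneousSubmodule σ K))
    {β : σ →₀ ℕ} (hβ : β ∈ leadingExponents (degRevLex τ) J) :
    ∃ f ∈ J, f.IsHomogeneous β.degree ∧ f ≠ 0 ∧ (degRevLex τ).degree f = β := by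
  obtain ⟨f, hf, hf0, rfl⟩ := hβ
  set β := (degRevLex τ).degree f
  have hc : coeff β (homogeneousComponent β.degree f) ≠ 0 := by
    rw [coeff_homogeneousComponent, if_pos rfl]
    exact (degRevLex τ).coeff_degree_ne_zero_iff.2 hf0
  refine ⟨homogeneousComponent β.degree f, homogeneousComponent_mem_of_mem hJ hf _,
    homogeneousComponent_isHomogeneous _ _, fun h0 => hc (by rw [h0, coeff_zero]),
    degree_eq_of_forall_le hc fun γ hγ => (degRevLex τ).le_degree ?_⟩
  rw [mem_support_iff, coeff_homogeneousComponent] at hγ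
  exact mem_support_iff.2 fun h0 => hγ (by simp [h0])

/-- For a reverse lexicographic order with smallest variable `X x` and a homogeneous ideal `J`, the
initial ideal of `(X x) + J` is `(X x)` plus the initial ideal of `J`. -/
theorem mem_leadingExponents_of_mem_leadingExponents_sup [Finite σ] {τ : σ ↪ ℕ} {x : σ}
    (hx : ∀ i, i ≠ x → τ x < τ i)
    {J : Ideal (MvPolynomial σ K)} (hJ : J.IsHomogeneous (homogeneousSubmodule σ K))
    {β : σ →₀ ℕ} (hβ : β ∈ leadingExponents (degRevLex τ) (Ideal.span {X x} ⊔ J))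
    (hβx : β x = 0) : β ∈ leadingExponents (degRevLex τ) J := by
  classical
  obtain ⟨g, hg, hg0, hgβ⟩ := hβ
  obtain ⟨u, hu, v, hv, rfl⟩ := Submodule.mem_sup.1 hg
  have hcoeff : ∀ γ : σ →₀ ℕ, γ x = 0 → coeff γ (u + v) = coeff γ v := by
    intro γ hγ
    have h0 : coeff γ u = 0 := by
      by_contra h
      exact X_dvd_iff_forall_mem_support.1 (Ideal.mem_span_singleton.1 hu) γ
        (mem_support_iff.2 h) hγ
    rw [coeff_add, h0, zero_add]
  have hc : coeff β (homogeneousComponent β.degree v) ≠ 0 := by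
    rw [coeff_homogeneousComponent, if_pos rfl, ← hcoeff β hβx, ← hgβ]
    exact (degRevLex τ).coeff_degree_ne_zero_iff.2 hg0
  refine ⟨_, homogeneousComponent_mem_of_mem hJ hv β.degree,
    fun h0 => hc (by rw [h0, coeff_zero]), degree_eq_of_forall_le hc fun γ hγ => ?_⟩
  rw [mem_support_iff, coeff_homogeneousComponent] at hγ
  have hdeg : γ.degree = β.degree := by
    by_contra h
    exact hγ (if_neg h)
  rw [if_pos hdeg] at hγ
  by_cases hγx : γ x = 0
  · rw [← hcoeff γ hγx] at hγ
    rw [← hgβ]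
    exact (degRevLex τ).le_degree (mem_support_iff.2 hγ)
  · refine ((degRevLex_lt_iff τ γ β).2 (Or.inr ⟨hdeg, x, by omega, fun j hj => ?_⟩)).le
    by_cases hjx : j = x
    · exact absurd hj (by rw [hjx]; exact lt_irrefl _)
    · exact absurd (hx j hjx) (not_lt.2 hj.le)

/-- Let `J` be homogeneous and Cohen–Macaulay with system of parameters `X x, X y`, where `X x` and
`X y` are the two smallest variables of a reverse lexicographic order. If `X x` does not divide the
minimal generators of the initial ideal of `J`, then neither does `X y`. -/
theorem isSaturatedIn_of_isCohenMacaulayIdeal [Finite σ] {τ : σ ↪ ℕ} {x y : σ} (hxy : y ≠ x)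
    (hx : ∀ i, i ≠ x → τ x < τ i) (hy : ∀ i, i ≠ x → i ≠ y → τ y < τ i)
    {J : Ideal (MvPolynomial σ K)} (hJ : J.IsHomogeneous (homogeneousSubmodule σ K))
    (hcm : IsCohenMacaulayIdeal J) (hsat : IsSaturatedIn (leadingExponents (degRevLex τ) J) x)
    (hpow : ∀ i, ∃ k : ℕ, X i ^ k ∈ Ideal.span {X y} ⊔ (Ideal.span {X x} ⊔ J))
    (hyE : ∀ k, Finsupp.single y k ∉ leadingExponents (degRevLex τ) J) :
    IsSaturatedIn (leadingExponents (degRevLex τ) J) y := by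
  classical
  -- it suffices to treat monomials that do not involve `X x`
  suffices hmain : ∀ α : σ →₀ ℕ, α x = 0 →
      α + Finsupp.single y 1 ∈ leadingExponents (degRevLex τ) J →
      α ∈ leadingExponents (degRevLex τ) J by
    intro α hα
    refine isUpperSet_leadingExponents ?_ (hmain (α.erase x) (by simp) ?_)
    · intro i
      by_cases hi : i = x
      · simp [hi]
      · simp [Finsupp.erase_ne hi]
    · convert hsat.erase_mem hα using 1
      ext i
      by_cases hi : i = x
      · subst hi; simp [hxy]
      · simp [Finsupp.erase_ne hi]
  intro α hαx hα
  have hL : (Ideal.span {X x} ⊔ J).IsHomogeneous (homogeneousSubmodule σ K) := by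
    refine Ideal.IsHomogeneous.sup (Ideal.homogeneous_span _ _ ?_) hJ
    rintro _ rfl
    exact ⟨1, isHomogeneous_X K x⟩
  obtain ⟨f, hf, hfhom, hf0, hfβ⟩ := exists_isHomogeneous_of_mem_leadingExponents hJ hα
  set β := α + Finsupp.single y 1 with hβ
  have hβx : β x = 0 := by simp [hβ, hαx, hxy]
  have hβd : β.degree = α.degree + 1 := by rw [hβ, map_add]; simp
  -- `g` is the part of `f` free of `X x`; it is divisible by `X y` since its initial monomial is
  set g := f.modMonomial (Finsupp.single x 1) with hg
  have hgcoeff : ∀ γ, γ x = 0 → coeff γ g = coeff γ f := fun γ hγ =>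
    coeff_modMonomial_of_not_le f (by rw [Finsupp.single_le_iff]; omega)
  have hgx : ∀ γ ∈ g.support, γ x = 0 := by
    intro γ hγ
    by_contra h
    refine mem_support_iff.1 hγ (coeff_modMonomial_of_le f ?_)
    rw [Finsupp.single_le_iff]; omega
  have hgsupp : ∀ γ ∈ g.support, γ ∈ f.support := fun γ hγ => by
    rw [mem_support_iff, ← hgcoeff γ (hgx γ hγ)]
    exact mem_support_iff.1 hγ
  have hgL : g ∈ Ideal.span {X x} ⊔ J := by
    have h1 := modMonomial_add_divMonomial_single f x
    rw [hg, eq_sub_of_add_eq h1]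
    exact Ideal.sub_mem _ (Ideal.mem_sup_right hf) (Ideal.mem_sup_left
      (Ideal.mem_span_singleton.2 ⟨_, rfl⟩))
  have hgβ : (degRevLex τ).degree g = β := by
    refine degree_eq_of_forall_le ?_ fun γ hγ => ?_
    · rw [hgcoeff β hβx, ← hfβ]
      exact (degRevLex τ).coeff_degree_ne_zero_iff.2 hf0
    · rw [← hfβ]
      exact (degRevLex τ).le_degree (hgsupp γ hγ)
  have hdvd : X y ∣ g := by
    refine X_dvd_iff_forall_mem_support.2 fun γ hγ hγy => ?_
    have hle := (degRevLex τ).le_degree hγ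
    rw [hgβ] at hle
    rcases hle.eq_or_lt with h | h
    · have h2 : γ = β := (degRevLex τ).toSyn.injective h
      simp [h2, hβ] at hγy
    · rcases (degRevLex_lt_iff τ γ β).1 h with h | ⟨-, i, hi, hj⟩
      · exact h.ne (hfhom.degree_eq_sum_deg_support (hgsupp γ hγ)).symm
      · have hix : i ≠ x := by
          rintro rfl
          rw [hgx γ hγ] at hi
          exact absurd hi (Nat.not_lt_zero _)
        by_cases hiy : i = y
        · subst hiy
          omega
        · have := hj y (hy i hix hiy)
          rw [hγy] at this
          simp [hβ] at this
  obtain ⟨z, hz⟩ := hdvd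
  have hghom : g.IsHomogeneous (α.degree + 1) := by
    intro γ hγ
    rw [← hβd]
    exact hfhom (mem_support_iff.1 (hgsupp γ (mem_support_iff.2 hγ)))
  have hzhom : z.IsHomogeneous α.degree := isHomogeneous_of_X_mul (by rwa [← hz])
  have hz0 : z ≠ 0 := by
    rintro rfl
    rw [hz, mul_zero, (degRevLex τ).degree_zero] at hgβ
    have := congrArg (fun δ => δ y) hgβ
    simp [hβ] at this
  have hzL : z ∈ Ideal.span {X x} ⊔ J := by
    refine mem_sup_of_X_mul_mem_sup_of_isCohenMacaulayIdeal hcm hL ?_ hpow ?_ hzhom (hz ▸ hgL)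
    · intro w hw
      exact mem_of_aeval_X_mul_mem hsat Polynomial.X_ne_zero (by rwa [Polynomial.aeval_X])
    · intro k hk
      refine hyE k (mem_leadingExponents_of_mem_leadingExponents_sup hx hJ
        ⟨X y ^ k, hk, pow_ne_zero _ (X_ne_zero y), ?_⟩ (by simp [hxy]))
      rw [MonomialOrder.degree_pow, MonomialOrder.degree_X]
      simp
  refine mem_leadingExponents_of_mem_leadingExponents_sup hx hJ ⟨z, hzL, hz0, ?_⟩ hαx
  rw [hz, (degRevLex τ).degree_mul (X_ne_zero y) hz0, MonomialOrder.degree_X, hβ,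
    add_comm α] at hgβ
  exact add_left_cancel hgβ

/-- If `X y` is a parameter modulo a Cohen–Macaulay initial ideal, then it does not divide the
minimal generators. -/
theorem isSaturatedIn_of_isCohenMacaulayIdeal_initialIdeal [Finite σ] {m : MonomialOrder σ}
    {I : Ideal (MvPolynomial σ K)} {y : σ} (hcm : IsCohenMacaulayIdeal (initialIdeal m I))
    (hpow : ∀ i, ∃ k : ℕ, X i ^ k ∈ Ideal.span {X y} ⊔ initialIdeal m I)
    (hyE : ∀ k, Finsupp.single y k ∉ leadingExponents m I) :
    IsSaturatedIn (leadingExponents m I) y := by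
  intro α hα
  refine monomial_mem_initialIdeal_iff.1 (mem_of_X_mul_mem_of_isCohenMacaulayIdeal (y := y)
    (d := α.degree) hcm
    (isHomogeneous_initialIdeal m I) hpow (fun k hk => hyE k ?_) (isHomogeneous_monomial 1 rfl) ?_)
  · rw [X_pow_eq_monomial] at hk
    exact monomial_mem_initialIdeal_iff.1 hk
  · rw [X, monomial_mul, one_mul, add_comm]
    exact monomial_mem_initialIdeal_iff.2 hα

end ReverseLexicographic

/-! ### Homogenization and leading exponents -/

section Homogenization

open scoped MonomialOrder

attribute [local instance] MvPolynomial.gradedAlgebra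

variable {K : Type*} [Field K] {n : ℕ}

theorem degree_eq_apply_zero_add_degree_tail (β : Fin (n + 1) →₀ ℕ) :
    β.degree = β 0 + β.tail.degree := by
  rw [Finsupp.degree_eq_sum, Finsupp.degree_eq_sum, Fin.sum_univ_succ]
  rfl

theorem eq_of_tail_eq_of_degree_eq {β γ : Fin (n + 1) →₀ ℕ} (h : β.tail = γ.tail)
    (hd : β.degree = γ.degree) : β = γ := by
  rw [degree_eq_apply_zero_add_degree_tail, degree_eq_apply_zero_add_degree_tail, h] at hd
  rw [← Finsupp.cons_tail β, ← Finsupp.cons_tail γ, h, Nat.add_right_cancel hd]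

theorem extendRanking_zero (ρ : Fin n ↪ ℕ) : extendRanking ρ 0 = 0 := rfl

theorem extendRanking_succ (ρ : Fin n ↪ ℕ) (i : Fin n) : extendRanking ρ i.succ = ρ i + 1 := rfl

/-- On monomials of the same degree, the extended order is compared after setting `x_0 = 1`. -/
theorem tail_le_tail_of_le (ρ : Fin n ↪ ℕ) {β γ : Fin (n + 1) →₀ ℕ} (hd : γ.degree = β.degree)
    (h : γ ≼[degRevLex (extendRanking ρ)] β) : γ.tail ≼[degRevLex ρ] β.tail := by
  rcases h.eq_or_lt with h | h
  · rw [(degRevLex (extendRanking ρ)).toSyn.injective h]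
  refine le_of_lt ((degRevLex_lt_iff ρ _ _).2 ?_)
  rcases (degRevLex_lt_iff _ γ β).1 h with h | ⟨-, i, hi, hj⟩
  · exact absurd hd h.ne
  rw [degree_eq_apply_zero_add_degree_tail, degree_eq_apply_zero_add_degree_tail β] at hd
  induction i using Fin.cases with
  | zero => left; omega
  | succ i =>
    have h0 : γ 0 = β 0 := hj 0 (by simp [extendRanking_zero, extendRanking_succ])
    refine Or.inr ⟨by omega, i, hi, fun j hlt => hj j.succ ?_⟩
    simpa [extendRanking_succ] using hlt

/-- The substitution `x_0 = 1`. -/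
noncomputable def dehomogenize : MvPolynomial (Fin (n + 1)) K →ₐ[K] MvPolynomial (Fin n) K :=
  aeval (Fin.cons 1 X)

theorem dehomogenize_monomial (β : Fin (n + 1) →₀ ℕ) (c : K) :
    dehomogenize (monomial β c) = monomial β.tail c := by
  rw [dehomogenize, aeval_monomial, monomial_eq, Finsupp.prod_fintype _ _ (by simp),
    Finsupp.prod_fintype _ _ (by simp), Fin.prod_univ_succ]
  simp [Finsupp.tail_apply]

theorem coeff_dehomogenize (g : MvPolynomial (Fin (n + 1)) K) (α : Fin n →₀ ℕ) :
    coeff α (dehomogenize g) = ∑ β ∈ g.support, if β.tail = α then coeff β g else 0 := by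
  conv_lhs => rw [g.as_sum]
  rw [map_sum, coeff_sum]
  exact Finset.sum_congr rfl fun β _ => by rw [dehomogenize_monomial, coeff_monomial]

theorem coeff_tail_dehomogenize {g : MvPolynomial (Fin (n + 1)) K} {β : Fin (n + 1) →₀ ℕ}
    (hg : g.IsHomogeneous β.degree) : coeff β.tail (dehomogenize g) = coeff β g := by
  rw [coeff_dehomogenize, Finset.sum_eq_single β]
  · rw [if_pos rfl]
  · intro γ hγ hne
    refine if_neg fun h => hne (eq_of_tail_eq_of_degree_eq h ?_)
    exact (hg.degree_eq_sum_deg_support hγ).symm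
  · intro h
    rw [if_pos rfl, notMem_support_iff.1 h]

theorem dehomogenize_ne_zero {g : MvPolynomial (Fin (n + 1)) K} {d : ℕ} (hg : g.IsHomogeneous d)
    (h0 : g ≠ 0) : dehomogenize g ≠ 0 := by
  obtain ⟨β, hβ⟩ := support_nonempty.2 h0
  intro h
  rw [hg.degree_eq_sum_deg_support hβ] at hg
  have := coeff_tail_dehomogenize hg
  rw [h, coeff_zero] at this
  exact mem_support_iff.1 hβ this.symm

theorem degree_dehomogenize (ρ : Fin n ↪ ℕ) {g : MvPolynomial (Fin (n + 1)) K} {d : ℕ}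
    (hg : g.IsHomogeneous d) (h0 : g ≠ 0) :
    (degRevLex ρ).degree (dehomogenize g) =
      ((degRevLex (extendRanking ρ)).degree g).tail := by
  set β := (degRevLex (extendRanking ρ)).degree g with hβ
  have hmem : β ∈ g.support := (degRevLex (extendRanking ρ)).degree_mem_support h0
  obtain rfl := hg.degree_eq_sum_deg_support hmem
  refine degree_eq_of_forall_le ?_ fun α hα => ?_
  · rw [coeff_tail_dehomogenize hg]
    exact mem_support_iff.1 hmem
  · rw [mem_support_iff, coeff_dehomogenize] at hα
    obtain ⟨γ, hγ, hne⟩ := Finset.exists_ne_zero_of_sum_ne_zero hα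
    have hγα : γ.tail = α := by
      by_contra h
      exact hne (if_neg h)
    rw [← hγα]
    exact tail_le_tail_of_le ρ (hg.degree_eq_sum_deg_support hγ).symm
      ((degRevLex (extendRanking ρ)).le_degree hγ)

theorem dehomogenize_homogenizePoly (f : MvPolynomial (Fin n) K) :
    dehomogenize (homogenizePoly f) = f := by
  rw [homogenizePoly, map_sum]
  conv_rhs => rw [f.as_sum]
  exact Finset.sum_congr rfl fun α _ => by rw [dehomogenize_monomial, Finsupp.tail_cons]

theorem isHomogeneous_homogenizePoly (f : MvPolynomial (Fin n) K) :
    (homogenizePoly f).IsHomogeneous f.totalDegree := by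
  refine IsHomogeneous.sum _ _ _ fun α hα => isHomogeneous_monomial _ ?_
  have hle : α.degree ≤ f.totalDegree := by
    rw [Finsupp.degree_eq_sum]
    have := le_totalDegree hα
    rwa [Finsupp.sum_fintype _ _ (by simp)] at this
  rw [degree_eq_apply_zero_add_degree_tail, Finsupp.cons_zero, Finsupp.tail_cons]
  omega

theorem totalDegree_eq_degree_degree (ρ : Fin n ↪ ℕ) {f : MvPolynomial (Fin n) K} (hf : f ≠ 0) :
    f.totalDegree = ((degRevLex ρ).degree f).degree := by
  have hsum : ∀ α : Fin n →₀ ℕ, (α.sum fun _ e => e) = α.degree := fun α => by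
    rw [Finsupp.degree_eq_sum, Finsupp.sum_fintype _ _ (by simp)]
  refine le_antisymm (Finset.sup_le fun α hα => ?_) ?_
  · rw [hsum]
    rcases ((degRevLex ρ).le_degree hα).eq_or_lt with h | h
    · rw [(degRevLex ρ).toSyn.injective h]
    · rcases (degRevLex_lt_iff ρ _ _).1 h with h | h
      exacts [h.le, h.1.le]
  · rw [← hsum]
    exact le_totalDegree ((degRevLex ρ).degree_mem_support hf)

variable {I : Ideal (MvPolynomial (Fin n) K)}

theorem isHomogeneous_homogenizeIdeal :
    (homogenizeIdeal I).IsHomogeneous (homogeneousSubmodule (Fin (n + 1)) K) := by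
  refine Ideal.homogeneous_span _ _ ?_
  rintro _ ⟨f, -, rfl⟩
  exact ⟨_, isHomogeneous_homogenizePoly f⟩

theorem dehomogenize_mem {g : MvPolynomial (Fin (n + 1)) K} (hg : g ∈ homogenizeIdeal I) :
    dehomogenize g ∈ I := by
  have hle : homogenizeIdeal I ≤ I.comap (dehomogenize : _ →ₐ[K] MvPolynomial (Fin n) K) := by
    refine Ideal.span_le.2 ?_
    rintro _ ⟨f, hf, rfl⟩
    change dehomogenize (homogenizePoly f) ∈ I
    rwa [dehomogenize_homogenizePoly]
  exact hle hg

/-- The initial ideal of the homogenization is the extension of the initial ideal of `I`. -/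
theorem mem_leadingExponents_homogenizeIdeal_iff {ρ : Fin n ↪ ℕ} {β : Fin (n + 1) →₀ ℕ} :
    β ∈ leadingExponents (degRevLex (extendRanking ρ)) (homogenizeIdeal I) ↔
      β.tail ∈ leadingExponents (degRevLex ρ) I := by
  constructor
  · intro hβ
    obtain ⟨g, hg, hhom, hg0, rfl⟩ :=
      exists_isHomogeneous_of_mem_leadingExponents isHomogeneous_homogenizeIdeal hβ
    exact ⟨dehomogenize g, dehomogenize_mem hg, dehomogenize_ne_zero hhom hg0,
      degree_dehomogenize ρ hhom hg0⟩
  · rintro ⟨f, hf, hf0, hdeg⟩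
    have h0 : homogenizePoly f ≠ 0 := fun h => hf0 (by
      rw [← dehomogenize_homogenizePoly f, h, map_zero])
    have hhom := isHomogeneous_homogenizePoly f
    set γ := (degRevLex (extendRanking ρ)).degree (homogenizePoly f) with hγ
    have htail : γ.tail = β.tail := by
      rw [hγ, ← degree_dehomogenize ρ hhom h0, dehomogenize_homogenizePoly, hdeg]
    -- the initial monomial of `f` has top degree, so it is not multiplied by a power of `x_0`
    have hγ0 : γ 0 = 0 := by
      have h1 : f.totalDegree = γ.degree := hhom.degree_eq_sum_deg_support
        ((degRevLex (extendRanking ρ)).degree_mem_support h0)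
      rw [totalDegree_eq_degree_degree ρ hf0, hdeg, ← htail] at h1
      have h2 := degree_eq_apply_zero_add_degree_tail γ
      omega
    refine isUpperSet_leadingExponents (a := γ) (fun i => ?_)
      ⟨_, Ideal.subset_span ⟨f, hf, rfl⟩, h0, rfl⟩
    induction i using Fin.cases with
    | zero => rw [hγ0]; exact Nat.zero_le _
    | succ i => exact (DFunLike.congr_fun htail i).le

theorem isSaturatedIn_zero_homogenizeIdeal {ρ : Fin n ↪ ℕ} :
    IsSaturatedIn (leadingExponents (degRevLex (extendRanking ρ)) (homogenizeIdeal I)) 0 := by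
  intro β hβ
  rw [mem_leadingExponents_homogenizeIdeal_iff] at hβ ⊢
  convert hβ using 1
  ext i
  simp [Finsupp.tail_apply]

theorem isSaturatedIn_succ_homogenizeIdeal_iff {ρ : Fin n ↪ ℕ} {i : Fin n} :
    IsSaturatedIn (leadingExponents (degRevLex (extendRanking ρ)) (homogenizeIdeal I)) i.succ ↔
      IsSaturatedIn (leadingExponents (degRevLex ρ) I) i := by
  have htail : ∀ β : Fin (n + 1) →₀ ℕ, (β + Finsupp.single i.succ 1).tail =
      β.tail + Finsupp.single i 1 := by
    intro β
    ext j
    simp [Finsupp.tail_apply, Finsupp.single_apply]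
  constructor
  · intro h α hα
    have := h (Finsupp.cons 0 α)
    rw [mem_leadingExponents_homogenizeIdeal_iff, mem_leadingExponents_homogenizeIdeal_iff,
      htail, Finsupp.tail_cons] at this
    exact this hα
  · intro h β hβ
    rw [mem_leadingExponents_homogenizeIdeal_iff] at hβ ⊢
    rw [htail] at hβ
    exact h _ hβ

/-- A homogeneous polynomial lies in `I^h` if its dehomogenization lies in `I`. -/
theorem mem_homogenizeIdeal_of_dehomogenize_mem (ρ : Fin n ↪ ℕ)
    {g : MvPolynomial (Fin (n + 1)) K} {d : ℕ} (hg : g.IsHomogeneous d)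
    (h : dehomogenize g ∈ I) : g ∈ homogenizeIdeal I := by
  obtain ⟨r, hr, hrs⟩ := exists_normalForm (degRevLex (extendRanking ρ)) (homogenizeIdeal I) g
  -- the normal form can be taken homogeneous
  set s := homogeneousComponent d r
  have hs : g - s ∈ homogenizeIdeal I := by
    have h1 := homogeneousComponent_mem_of_mem isHomogeneous_homogenizeIdeal hr d
    rwa [map_sub, homogeneousComponent_eq_self hg] at h1
  have hshom : s.IsHomogeneous d := homogeneousComponent_isHomogeneous d r
  have hsI : dehomogenize s ∈ I := by
    have h1 := I.sub_mem h (dehomogenize_mem hs)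
    rwa [map_sub, sub_sub_cancel] at h1
  by_cases hs0 : s = 0
  · rwa [hs0, sub_zero] at hs
  · have hmem := (degRevLex (extendRanking ρ)).degree_mem_support hs0
    refine absurd (mem_leadingExponents_homogenizeIdeal_iff.2
      ⟨_, hsI, dehomogenize_ne_zero hshom hs0, degree_dehomogenize ρ hshom hs0⟩) (hrs _ ?_)
    rw [mem_support_iff, coeff_homogeneousComponent] at hmem
    exact mem_support_iff.2 fun h0 => hmem (by rw [h0, ite_self])

end Homogenization

/-! ### Initial ideals modulo a variable -/

section ModuloVariable

variable {σ K : Type*} [Field K] {m : MonomialOrder σ} {I : Ideal (MvPolynomial σ K)} {i : σ}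

theorem sup_initialIdeal_le (m : MonomialOrder σ) (I : Ideal (MvPolynomial σ K)) (i : σ) :
    Ideal.span {X i} ⊔ initialIdeal m I ≤ initialIdeal m (Ideal.span {X i} ⊔ I) := by
  refine sup_le ((Ideal.span_singleton_le_iff_mem _).2 ?_) (initialIdeal_mono le_sup_right)
  refine monomial_mem_initialIdeal_iff.2 ⟨X i, Ideal.mem_sup_left
    (Ideal.mem_span_singleton_self _), X_ne_zero i, m.degree_X⟩

theorem coeff_eq_zero_of_mem_span_X {u : MvPolynomial σ K} (hu : u ∈ Ideal.span {X i})
    {α : σ →₀ ℕ} (hα : α i = 0) : coeff α u = 0 := by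
  by_contra h
  exact X_dvd_iff_forall_mem_support.1 (Ideal.mem_span_singleton.1 hu) α
    (mem_support_iff.2 h) hα

/-- If `X i` does not divide the minimal generators of the initial ideal, then passing to the
initial ideal commutes with adding `X i`: an element of `(X i) + I` can be written as
`X i * h + g` with `g ∈ I` and `h` in normal form, and then the initial monomial of `g` cannot
cancel. -/
theorem initialIdeal_sup_eq_of_isSaturatedIn (hi : IsSaturatedIn (leadingExponents m I) i) :
    initialIdeal m (Ideal.span {X i} ⊔ I) = Ideal.span {X i} ⊔ initialIdeal m I := by
  refine le_antisymm (Ideal.span_le.2 ?_) (sup_initialIdeal_le m I i)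
  rintro _ ⟨f, hf, hf0, rfl⟩
  rw [SetLike.mem_coe]
  by_cases hα : m.degree f i = 0
  swap
  · exact Ideal.mem_sup_left (Ideal.mem_span_singleton.2 (X_dvd_monomial_one_iff.2 hα))
  refine Ideal.mem_sup_right (monomial_mem_initialIdeal_iff.2 ?_)
  obtain ⟨u, hu, v, hv, rfl⟩ := Submodule.mem_sup.1 hf
  obtain ⟨h, rfl⟩ := Ideal.mem_span_singleton.1 hu
  obtain ⟨r, hr, hrs⟩ := exists_normalForm m I h
  set g := X i * (h - r) + v with hg
  have hgI : g ∈ I := I.add_mem (I.mul_mem_left _ hr) hv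
  have hfg : X i * h + v = X i * r + g := by rw [hg]; ring
  rw [hfg] at hf0 hα ⊢
  set f := X i * r + g with hf
  have hcg : coeff (m.degree f) g ≠ 0 := by
    have h1 : coeff (m.degree f) f = coeff (m.degree f) g := by
      rw [hf, coeff_add, coeff_eq_zero_of_mem_span_X (Ideal.mul_mem_right _ _
        (Ideal.mem_span_singleton_self _)) hα, zero_add]
    rw [← h1]
    exact m.coeff_degree_ne_zero_iff.2 hf0
  have hg0 : g ≠ 0 := fun h0 => hcg (by rw [h0, coeff_zero])
  rcases (m.le_degree (mem_support_iff.2 hcg)).eq_or_lt with heq | hlt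
  · rw [m.toSyn.injective heq]
    exact ⟨g, hgI, hg0, rfl⟩
  · have h1 := m.coeff_eq_zero_of_lt hlt
    rw [hf, coeff_add] at h1
    refine absurd ⟨g, hgI, hg0, rfl⟩
      (support_X_mul_of_isSaturatedIn hi hrs (m.degree g) (mem_support_iff.2 fun h2 => ?_))
    rw [h2, zero_add] at h1
    exact m.coeff_degree_ne_zero_iff.2 hg0 h1

/-- If passing to the initial ideal commutes with adding `X i`, then the reduced element of `I`
with a given initial monomial divisible by `X i` is itself divisible by `X i`. -/
theorem isSaturatedIn_of_initialIdeal_sup_eq (hreg : ∀ z, X i * z ∈ I → z ∈ I)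
    (heq : initialIdeal m (Ideal.span {X i} ⊔ I) = Ideal.span {X i} ⊔ initialIdeal m I) :
    IsSaturatedIn (leadingExponents m I) i := by
  classical
  intro α hα
  set β := α + Finsupp.single i 1 with hβ
  have hβi : β i ≠ 0 := by simp [hβ]
  obtain ⟨r, hr, hrs⟩ := exists_normalForm m I (monomial β (1 : K))
  set p := monomial β (1 : K) - r with hp
  have hsupp : ∀ γ ∈ p.support, γ = β ∨ γ ∈ r.support := by
    intro γ hγ
    by_contra hcon
    rw [not_or, notMem_support_iff] at hcon
    rw [mem_support_iff, hp, coeff_sub, coeff_monomial, if_neg (Ne.symm hcon.1), hcon.2] at hγ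
    simp at hγ
  have hp0 : p ≠ 0 := by
    intro h0
    have h1 : coeff β p = 1 := by
      rw [hp, coeff_sub, coeff_monomial, if_pos rfl,
        notMem_support_iff.1 fun h => hrs β h hα, sub_zero]
    rw [h0, coeff_zero] at h1
    exact zero_ne_one h1
  have hpdeg : m.degree p = β := (hsupp _ (m.degree_mem_support hp0)).resolve_right
    fun h => hrs _ h ⟨p, hr, hp0, rfl⟩
  have hdvd : X i ∣ p := by
    rw [X_dvd_iff_modMonomial_eq_zero]
    by_contra hg0
    set g := p.modMonomial (Finsupp.single i 1) with hg
    have hgmem : m.degree g ∈ g.support := m.degree_mem_support hg0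
    have hgi : m.degree g i = 0 := by
      by_contra h
      refine mem_support_iff.1 hgmem (coeff_modMonomial_of_le p ?_)
      rw [Finsupp.single_le_iff]; omega
    have hgp : m.degree g ∈ p.support := by
      rw [mem_support_iff, ← coeff_modMonomial_of_not_le p
        (s := Finsupp.single i 1) (by rw [Finsupp.single_le_iff]; omega)]
      exact mem_support_iff.1 hgmem
    have hgL : g ∈ Ideal.span {X i} ⊔ I := by
      rw [hg, eq_sub_of_add_eq (modMonomial_add_divMonomial_single p i)]
      exact Ideal.sub_mem _ (Ideal.mem_sup_right hr) (Ideal.mem_sup_left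
        (Ideal.mem_span_singleton.2 ⟨_, rfl⟩))
    have hmon : monomial (m.degree g) (1 : K) ∈ initialIdeal m (Ideal.span {X i} ⊔ I) :=
      monomial_mem_initialIdeal_iff.2 ⟨g, hgL, hg0, rfl⟩
    rw [heq] at hmon
    obtain ⟨u, hu, v, hv, huv⟩ := Submodule.mem_sup.1 hmon
    have hc := congrArg (coeff (m.degree g)) huv
    rw [coeff_add, coeff_eq_zero_of_mem_span_X hu hgi, zero_add, coeff_monomial, if_pos rfl] at hc
    have hgE : m.degree g ∈ leadingExponents m I :=
      mem_initialIdeal_iff.1 hv _ (mem_support_iff.2 (by rw [hc]; exact one_ne_zero))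
    rcases hsupp _ hgp with h | h
    · exact hβi (h ▸ hgi)
    · exact hrs _ h hgE
  obtain ⟨q, hq⟩ := hdvd
  have hq0 : q ≠ 0 := by
    rintro rfl
    exact hp0 (by rw [hq, mul_zero])
  refine ⟨q, hreg q (hq ▸ hr), hq0, ?_⟩
  rw [hq, m.degree_mul (X_ne_zero i) hq0, m.degree_X, hβ, add_comm α] at hpdeg
  exact add_left_cancel hpdeg

end ModuloVariable

/-! ### The ideal of a monomial curve -/

section MonomialCurve

attribute [local instance] MvPolynomial.gradedAlgebra

variable {K : Type*} [Field K] {n : ℕ} {a : Fin (n + 1) → ℕ}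

theorem mem_of_X_mul_mem_monomialCurveIdeal (i : Fin (n + 1)) {z : MvPolynomial (Fin (n + 1)) K}
    (h : X i * z ∈ monomialCurveIdeal K a) : z ∈ monomialCurveIdeal K a := by
  rw [monomialCurveIdeal, RingHom.mem_ker, map_mul, aeval_X] at h
  exact (mul_eq_zero.1 h).resolve_left (pow_ne_zero _ Polynomial.X_ne_zero)

theorem X_pow_sub_X_pow_mem_monomialCurveIdeal (i j : Fin (n + 1)) :
    X i ^ a j - X j ^ a i ∈ monomialCurveIdeal K a := by
  rw [monomialCurveIdeal, RingHom.mem_ker, map_sub, map_pow, map_pow, aeval_X, aeval_X,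
    ← pow_mul, ← pow_mul, mul_comm, sub_self]

theorem single_mem_leadingExponents_monomialCurveIdeal (ρ : Fin (n + 1) ↪ ℕ) {i : Fin (n + 1)}
    (hi : a i < a (Fin.last n)) :
    Finsupp.single i (a (Fin.last n)) ∈
      leadingExponents (degRevLex ρ) (monomialCurveIdeal K a) := by
  have hlt : (degRevLex ρ).toSyn ((degRevLex ρ).degree (X (Fin.last n) ^ a i :
      MvPolynomial (Fin (n + 1)) K)) < (degRevLex ρ).toSyn ((degRevLex ρ).degree
      (X i ^ a (Fin.last n) : MvPolynomial (Fin (n + 1)) K)) := by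
    rw [MonomialOrder.degree_pow, MonomialOrder.degree_pow, MonomialOrder.degree_X,
      MonomialOrder.degree_X, degRevLex_lt_iff]
    left
    simpa using hi
  refine ⟨_, X_pow_sub_X_pow_mem_monomialCurveIdeal i (Fin.last n), fun h0 => ?_, ?_⟩
  · rw [sub_eq_zero.1 h0] at hlt
    exact lt_irrefl _ hlt
  · rw [MonomialOrder.degree_sub_of_lt hlt, MonomialOrder.degree_pow, MonomialOrder.degree_X]
    simp

theorem coeff_aeval_X_pow (f : MvPolynomial (Fin n) K) (b : Fin n → ℕ) (w : ℕ) :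
    (aeval (fun i => (Polynomial.X : Polynomial K) ^ b i) f).coeff w =
      ∑ α ∈ f.support, if w = ∑ i, b i * α i then f.coeff α else 0 := by
  conv_lhs => rw [f.as_sum]
  rw [map_sum, Polynomial.finsetSum_coeff]
  refine Finset.sum_congr rfl fun α _ => ?_
  rw [aeval_monomial, Finsupp.prod_fintype _ _ (by simp)]
  simp_rw [← pow_mul]
  rw [Finset.prod_pow_eq_pow_sum, Polynomial.algebraMap_eq, Polynomial.coeff_C_mul_X_pow]

/-- No power of the last variable is an initial monomial: among all monomials of degree at most `k`,
only `x_n ^ k` is mapped to `t ^ (k * a_n)`. -/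
theorem single_last_notMem_leadingExponents_monomialCurveIdeal
    (hmax : ∀ i, i ≠ Fin.last n → a i < a (Fin.last n)) (ha : 0 < a (Fin.last n))
    (ρ : Fin (n + 1) ↪ ℕ) (k : ℕ) :
    Finsupp.single (Fin.last n) k ∉ leadingExponents (degRevLex ρ) (monomialCurveIdeal K a) := by
  rintro ⟨f, hf, hf0, hdeg⟩
  rw [monomialCurveIdeal, RingHom.mem_ker] at hf
  have hmem := (degRevLex ρ).degree_mem_support hf0
  have hc := coeff_aeval_X_pow f a (a (Fin.last n) * k)
  rw [hf, Polynomial.coeff_zero, Finset.sum_eq_single (Finsupp.single (Fin.last n) k)] at hc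
  · rw [if_pos (by
      rw [Finset.sum_eq_single (Fin.last n)]
      · simp
      · intro i _ hi
        simp [hi.symm]
      · simp)] at hc
    rw [hdeg] at hmem
    exact mem_support_iff.1 hmem hc.symm
  · intro α hα hne
    refine if_neg fun hw => hne ?_
    have hdegle : α.degree ≤ k := by
      have h1 := totalDegree_eq_degree_degree ρ hf0
      rw [hdeg, Finsupp.degree_single] at h1
      rw [← h1, Finsupp.degree_eq_sum]
      have := le_totalDegree hα
      rwa [Finsupp.sum_fintype _ _ (by simp)] at this
    have hle : ∀ i, a i * α i ≤ a (Fin.last n) * α i := fun i => by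
      by_cases hi : i = Fin.last n
      · rw [hi]
      · exact Nat.mul_le_mul_right _ (hmax i hi).le
    have hsum : ∑ i, a (Fin.last n) * α i = a (Fin.last n) * α.degree := by
      rw [Finsupp.degree_eq_sum, Finset.mul_sum]
    have hle2 : a (Fin.last n) * α.degree ≤ a (Fin.last n) * k := Nat.mul_le_mul_left _ hdegle
    have heq : ∑ i, a i * α i = ∑ i, a (Fin.last n) * α i :=
      le_antisymm (Finset.sum_le_sum fun i _ => hle i) (by omega)
    have hzero : ∀ i, i ≠ Fin.last n → α i = 0 := by
      intro i hi
      have h1 := (Finset.sum_eq_sum_iff_of_le fun i _ => hle i).1 heq i (Finset.mem_univ i)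
      by_contra h0
      exact (Nat.mul_lt_mul_of_pos_right (hmax i hi) (Nat.pos_of_ne_zero h0)).ne h1
    have hαd : α.degree = k := by
      refine le_antisymm hdegle (Nat.le_of_mul_le_mul_left ?_ ha)
      rw [← hsum, ← heq, hw]
    have hαs : α = Finsupp.single (Fin.last n) (α (Fin.last n)) := by
      ext i
      by_cases hi : i = Fin.last n
      · rw [hi, Finsupp.single_eq_same]
      · rw [hzero i hi, Finsupp.single_apply, if_neg (Ne.symm hi)]
    rw [hαs, Finsupp.degree_single] at hαd
    rw [hαs, hαd]
  · intro h
    rw [hdeg] at hmem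
    exact absurd hmem h

/-- The homogenization of the binomial `x_i ^ a_n - x_n ^ a_i`. -/
theorem X_pow_sub_mem_homogenizeIdeal_monomialCurveIdeal {i : Fin (n + 1)}
    (hi : a i ≤ a (Fin.last n)) :
    X i.succ ^ a (Fin.last n) - X (Fin.last (n + 1)) ^ a i * X 0 ^ (a (Fin.last n) - a i) ∈
      homogenizeIdeal (monomialCurveIdeal K a) := by
  -- any ranking of the variables serves here
  refine mem_homogenizeIdeal_of_dehomogenize_mem Fin.valEmbedding (d := a (Fin.last n)) ?_ ?_
  · refine (isHomogeneous_X_pow _ _).sub ?_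
    have h := (isHomogeneous_X_pow (R := K) (Fin.last (n + 1)) (a i)).mul
      (isHomogeneous_X_pow (0 : Fin (n + 1 + 1)) (a (Fin.last n) - a i))
    rwa [Nat.add_sub_cancel' hi] at h
  · rw [← Fin.succ_last]
    simpa [dehomogenize] using X_pow_sub_X_pow_mem_monomialCurveIdeal (K := K) (a := a) i
      (Fin.last n)

theorem single_succ_mem_leadingExponents_homogenizeIdeal (ρ : Fin (n + 1) ↪ ℕ) {i : Fin (n + 1)}
    (hi : a i < a (Fin.last n)) :
    Finsupp.single i.succ (a (Fin.last n)) ∈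
      leadingExponents (degRevLex (extendRanking ρ))
        (homogenizeIdeal (monomialCurveIdeal K a)) := by
  rw [mem_leadingExponents_homogenizeIdeal_iff]
  convert single_mem_leadingExponents_monomialCurveIdeal ρ hi using 1
  ext j
  simp [Finsupp.tail_apply, Finsupp.single_apply]

/-- For a homogeneous ideal with the same initial ideal as `I(a)^h`, and modulo which `X 0` and
the last variable are parameters, the Cohen–Macaulay property forces the last variable not to
divide the minimal generators of the initial ideal. -/
theorem isSaturatedIn_last_of_isCohenMacaulayIdeal
    (hmax : ∀ i, i ≠ Fin.last n → a i < a (Fin.last n)) (ha : 0 < a (Fin.last n))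
    {ρ : Fin (n + 1) ↪ ℕ} (hρ : ∀ i, i ≠ Fin.last n → ρ (Fin.last n) < ρ i)
    {J : Ideal (MvPolynomial (Fin (n + 1 + 1)) K)}
    (hJ : J.IsHomogeneous (homogeneousSubmodule (Fin (n + 1 + 1)) K))
    (hE : leadingExponents (degRevLex (extendRanking ρ)) J =
      leadingExponents (degRevLex (extendRanking ρ)) (homogenizeIdeal (monomialCurveIdeal K a)))
    (hpow : ∀ i : Fin (n + 1), ∃ k : ℕ, X i.succ ^ k ∈ Ideal.span {X (Fin.last (n + 1))} ⊔ J)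
    (hcm : IsCohenMacaulayIdeal J) :
    IsSaturatedIn (leadingExponents (degRevLex ρ) (monomialCurveIdeal K a)) (Fin.last n) := by
  rw [← isSaturatedIn_succ_homogenizeIdeal_iff, ← hE, Fin.succ_last]
  refine isSaturatedIn_of_isCohenMacaulayIdeal (x := 0) (Fin.last_pos).ne' ?_ ?_ hJ hcm ?_ ?_ ?_
  · intro i hi
    obtain ⟨i, rfl⟩ := Fin.exists_succ_eq.2 hi
    rw [extendRanking_zero, extendRanking_succ]
    exact Nat.succ_pos _
  · intro i hi hil
    obtain ⟨i, rfl⟩ := Fin.exists_succ_eq.2 hi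
    rw [← Fin.succ_last, extendRanking_succ, extendRanking_succ]
    exact Nat.succ_lt_succ (hρ i fun h => hil (by rw [h, Fin.succ_last]))
  · rw [hE]
    exact isSaturatedIn_zero_homogenizeIdeal
  · intro i
    induction i using Fin.cases with
    | zero =>
      refine ⟨1, Ideal.mem_sup_right (Ideal.mem_sup_left ?_)⟩
      rw [pow_one]
      exact Ideal.mem_span_singleton_self _
    | succ i =>
      obtain ⟨k, hk⟩ := hpow i
      have hle : Ideal.span {X (Fin.last (n + 1))} ⊔ J ≤
          Ideal.span {X (Fin.last (n + 1))} ⊔ (Ideal.span {X 0} ⊔ J) :=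
        sup_le_sup_left le_sup_right _
      exact ⟨k, hle hk⟩
  · intro k hk
    rw [hE, mem_leadingExponents_homogenizeIdeal_iff] at hk
    refine single_last_notMem_leadingExponents_monomialCurveIdeal (K := K) hmax ha ρ k ?_
    convert hk using 1
    ext j
    simp [Finsupp.tail_apply, Finsupp.single_apply, ← Fin.succ_last]

end MonomialCurve

theorem theorem1p2 {K : Type*} [Field K] (n : ℕ)
    -- the sequence `a_1, …, a_{n+1}`, with `a_{n+1}` the largest entry
    (a : Fin (n + 1) → ℕ) (ha : ∀ i, 0 < a i)
    (hmax : ∀ i, i ≠ Fin.last n → a i < a (Fin.last n))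
    -- the ranking of the variables, with the last variable the smallest
    (ρ : Fin (n + 1) ↪ ℕ) (hρ : ∀ i, i ≠ Fin.last n → ρ (Fin.last n) < ρ i) :
    List.TFAE [
      -- (a)
      IsArithmeticallyCohenMacaulay K a,
      -- (b)
      IsCohenMacaulayIdeal (initialIdeal (degRevLex (extendRanking ρ))
        (homogenizeIdeal (monomialCurveIdeal K a))),
      -- (c)
      IsCohenMacaulayIdeal (initialIdeal (degRevLex ρ) (monomialCurveIdeal K a)),
      -- (d)
      ∀ u ∈ minimalMonomialGenerators (initialIdeal (degRevLex ρ) (monomialCurveIdeal K a)),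
        ¬ MvPolynomial.X (Fin.last n) ∣ u,
      -- (e)
      ∀ u ∈ minimalMonomialGenerators (initialIdeal (degRevLex (extendRanking ρ))
          (homogenizeIdeal (monomialCurveIdeal K a))),
        ¬ MvPolynomial.X (Fin.last (n + 1)) ∣ u ∧ ¬ MvPolynomial.X 0 ∣ u,
      -- (f)
      ∀ u ∈ minimalMonomialGenerators (initialIdeal (degRevLex (extendRanking ρ))
          (homogenizeIdeal (monomialCurveIdeal K a))),
        ¬ MvPolynomial.X (Fin.last (n + 1)) ∣ u,
      -- (g)
      initialIdeal (degRevLex ρ)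
          (Ideal.span {MvPolynomial.X (Fin.last n)} ⊔ monomialCurveIdeal K a) =
        Ideal.span {MvPolynomial.X (Fin.last n)} ⊔
          initialIdeal (degRevLex ρ) (monomialCurveIdeal K a)] := by
  have hle : ∀ i, a i ≤ a (Fin.last n) := fun i => by
    by_cases hi : i = Fin.last n
    · rw [hi]
    · exact (hmax i hi).le
  have hd : _ ↔ IsSaturatedIn (leadingExponents (degRevLex ρ) (monomialCurveIdeal K a))
    (Fin.last n) := forall_minimalMonomialGenerators_iff
  have hf := forall_minimalMonomialGenerators_iff (m := degRevLex (extendRanking ρ))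
    (I := homogenizeIdeal (monomialCurveIdeal K a)) (i := Fin.last (n + 1))
  rw [← Fin.succ_last, isSaturatedIn_succ_homogenizeIdeal_iff, ← hd, Fin.succ_last] at hf
  have h0 := (forall_minimalMonomialGenerators_iff (m := degRevLex (extendRanking ρ))
    (I := homogenizeIdeal (monomialCurveIdeal K a)) (i := 0)).2 isSaturatedIn_zero_homogenizeIdeal
  tfae_have 6 ↔ 4 := hf
  tfae_have 5 → 6 := fun h u hu => (h u hu).1
  tfae_have 6 → 5 := fun h u hu => ⟨h u hu, h0 u hu⟩
  tfae_have 4 → 7 := fun h => initialIdeal_sup_eq_of_isSaturatedIn (hd.1 h)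
  tfae_have 7 → 4 := fun h => hd.2 (isSaturatedIn_of_initialIdeal_sup_eq
    (fun _ => mem_of_X_mul_mem_monomialCurveIdeal _) h)
  tfae_have 4 → 3 := by
    intro h
    refine isCohenMacaulayIdeal_of_isSaturatedIn (m := degRevLex ρ) (i := Fin.last n)
      (by rw [leadingExponents_initialIdeal]; exact hd.1 h) fun l => ?_
    by_cases hl : l = Fin.last n
    · exact ⟨1, one_pos, X (Fin.last n), Algebra.subset_adjoin rfl, by simp [hl]⟩
    · refine ⟨a (Fin.last n), ha _, 0, zero_mem _, ?_⟩
      rw [sub_zero, X_pow_eq_monomial]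
      exact monomial_mem_initialIdeal_iff.2
        (single_mem_leadingExponents_monomialCurveIdeal ρ (hmax l hl))
  tfae_have 3 → 4 := by
    intro h
    refine hd.2 (isSaturatedIn_of_isCohenMacaulayIdeal_initialIdeal h (fun l => ?_)
      (single_last_notMem_leadingExponents_monomialCurveIdeal hmax (ha _) ρ))
    by_cases hl : l = Fin.last n
    · refine ⟨1, Ideal.mem_sup_left ?_⟩
      rw [hl, pow_one]
      exact Ideal.mem_span_singleton_self _
    · refine ⟨a (Fin.last n), Ideal.mem_sup_right ?_⟩
      rw [X_pow_eq_monomial]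
      exact monomial_mem_initialIdeal_iff.2
        (single_mem_leadingExponents_monomialCurveIdeal ρ (hmax l hl))
  tfae_have 4 → 2 := by
    intro h
    refine isCohenMacaulayIdeal_of_isSaturatedIn_zero_of_isSaturatedIn_succ
      (m := degRevLex (extendRanking ρ)) (j := Fin.last n) ?_ ?_ fun l => ?_
    · rw [leadingExponents_initialIdeal]
      exact isSaturatedIn_zero_homogenizeIdeal
    · rw [leadingExponents_initialIdeal]
      exact isSaturatedIn_succ_homogenizeIdeal_iff.2 (hd.1 h)
    · induction l using Fin.cases with
      | zero => exact ⟨1, one_pos, X 0, Algebra.subset_adjoin (by simp), by simp⟩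
      | succ l =>
        by_cases hl : l = Fin.last n
        · exact ⟨1, one_pos, X (Fin.last n).succ, Algebra.subset_adjoin (by simp), by simp [hl]⟩
        · refine ⟨a (Fin.last n), ha _, 0, zero_mem _, ?_⟩
          rw [sub_zero, X_pow_eq_monomial]
          exact monomial_mem_initialIdeal_iff.2
            (single_succ_mem_leadingExponents_homogenizeIdeal ρ (hmax l hl))
  tfae_have 2 → 4 := by
    intro h
    refine hd.2 (isSaturatedIn_last_of_isCohenMacaulayIdeal hmax (ha _) hρ
      (isHomogeneous_initialIdeal _ _) leadingExponents_initialIdeal (fun l => ?_) h)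
    by_cases hl : l = Fin.last n
    · refine ⟨1, Ideal.mem_sup_left ?_⟩
      rw [hl, pow_one, Fin.succ_last]
      exact Ideal.mem_span_singleton_self _
    · refine ⟨a (Fin.last n), Ideal.mem_sup_right ?_⟩
      rw [X_pow_eq_monomial]
      exact monomial_mem_initialIdeal_iff.2
        (single_succ_mem_leadingExponents_homogenizeIdeal ρ (hmax l hl))
  tfae_have 4 → 1 := by
    intro h
    refine isCohenMacaulayIdeal_of_isSaturatedIn_zero_of_isSaturatedIn_succ
      (m := degRevLex (extendRanking ρ)) (j := Fin.last n) isSaturatedIn_zero_homogenizeIdeal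
      (isSaturatedIn_succ_homogenizeIdeal_iff.2 (hd.1 h)) fun l => ?_
    induction l using Fin.cases with
    | zero => exact ⟨1, one_pos, X 0, Algebra.subset_adjoin (by simp), by simp⟩
    | succ l =>
      refine ⟨a (Fin.last n), ha _, _, ?_,
        X_pow_sub_mem_homogenizeIdeal_monomialCurveIdeal (hle l)⟩
      exact mul_mem (pow_mem (Algebra.subset_adjoin (by simp)) _)
        (pow_mem (Algebra.subset_adjoin (by simp)) _)
  tfae_have 1 → 4 := by
    intro h
    refine hd.2 (isSaturatedIn_last_of_isCohenMacaulayIdeal hmax (ha _) hρ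
      isHomogeneous_homogenizeIdeal rfl (fun l => ⟨a (Fin.last n), ?_⟩) h)
    rw [← sub_add_cancel (X l.succ ^ a (Fin.last n))
      (X (Fin.last (n + 1)) ^ a l * X 0 ^ (a (Fin.last n) - a l))]
    refine Ideal.add_mem _ (Ideal.mem_sup_right
      (X_pow_sub_mem_homogenizeIdeal_monomialCurveIdeal (hle l))) (Ideal.mem_sup_left
      (Ideal.mul_mem_right _ _ (Ideal.pow_mem_of_mem _ (Ideal.mem_span_singleton_self _) _ (ha l))))
  tfae_finish
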